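/- **Model.** A network is a connected undirected graph $G=(V,E)$ with $n=|V|\ge 2$ nodes and nonnegative integer edge weights; nodes have distinct identity numbers, and identities and weights are at most $n^{a}$ for a constant $a$. $d(u,v)$ is the weighted shortest-path distance, and $S=\max_{u,v}h(u,v)$, where $h(u,v)$ is the least number of edges of a simple $u$–$v$ path of weight $d(u,v)$. Computation is in the synchronous CONGEST model: initially a node knows $n$, $\varepsilon$, $k$, $a$, its own identity, the identities of its neighbours and the weights of its incident edges, and it has a private source of independent uniform random numbers in $[0,1]$; in every round it may send one message of $O_a(\log n)$ bits over each incident edge. It does not know $S$. A word holds an identity or a distance. **Sketches.** $v$ is *$\varepsilon$-far* from $u$ if $|\{w:d(u,w)<d(u,v)\}|\ge\varepsilon n$. With $R(u,\varepsilon)=\inf\{r\ge 0:|\{v:d(u,v)\le r\}|\ge\varepsilon n\}$, a set $N\subseteq V$ is an *$\varepsilon$-density net* if every $u$ has some $v\in N$ with $d(u,v)\le R(u,\varepsilon)$, and $|N|\le\frac{10}{\varepsilon}\ln n$. Let $A_0=N$ contain every node independently with probability $\min(1,\frac{5\ln n}{\varepsilon n})$; for $1\le i\le k-1$ let $A_i$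 contain every node of $A_{i-1}$ independently with probability $(\frac{10}{\varepsilon}\ln n)^{-1/k}$; let $A_k=\emptyset$ and $d(u,\emptyset)=\infty$. The Thorup–Zwick label of $u$ consists, for each $0\le i\le k-1$, of a point $p_i(u)$ of $A_i$ closest to $u$ (absent if $A_i=\emptyset$) and the set $B_i(u)=\{w\in A_i:d(u,w)<d(u,A_{i+1})\}$, all nodes being stored as identities together with their distances from $u$. The *$(\varepsilon,k)$-CDG sketch* of $u$ consists of the identity of a point $u'\in N$ closest to $u$, the distance $d(u,u')$, and the Thorup–Zwick label of $u'$. From the sketches of $u$ and $v$ one computes the estimate $d'(u,v)=d(u,u')+d''(u',v')+d(v',v)$, where $d''(x,y)=d(x,p)+d(y,p)$ for the pivot $p$ found at the first level $i$ with $p=p_i(x)\in B_i(y)$ or $p=p_i(y)\in B_i(x)$. The sketches have *stretch $\alpha$ with $\varepsilon$-slack* if $d'(u,v)$ is defined and $d(u,v)\le d'(u,v)\le\alpha\, d(u,v)$ for all $u,v$ such that $v$ is $\varepsilon$-far from $u$. **Theorem.** For every constant $C>0$ there is a constant $K$ such that the following holds for all $n\ge 2$, $\varepsilon>0$ and integers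 $k$ with $1\le k\le C\log\frac1\varepsilon$ (and every constant $a$). There is a randomized distributed algorithm that, on every such network with $n$ nodes, always terminates, in at most $$K\,k\,S\left(\tfrac1\varepsilon\log n\right)^{1/k}\log n\ \text{ rounds and with at most }\ K\,k\,S\,|E|\left(\tfrac1\varepsilon\log n\right)^{1/k}\log n\ \text{ messages},$$ and such that with probability at least $1-\frac1n$ the following hold simultaneously: the random set $N$ is an $\varepsilon$-density net; every node outputs its $(\varepsilon,k)$-CDG sketch for the random hierarchy $N=A_0\supseteq A_1\supseteq\dots\supseteq A_k=\emptyset$; every sketch has at most $K\,k\left(\frac1\varepsilon\log n\right)^{1/k}\log n$ words; and the sketches have stretch $8k-1$ with $\varepsilon$-slack. -/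

import Mathlib

open MeasureTheory

/-! ### Weighted networks -/

/-- A connected undirected graph with nonnegative integer edge weights whose nodes carry distinct
identity numbers.  Only the values of `weight` on edges matter. -/
structure Network (V : Type*) where
  graph : SimpleGraph V
  connected : graph.Connected
  weight : Sym2 V → ℕ
  ident : V → ℕ
  ident_injective : Function.Injective ident

namespace Network

variable {V : Type*}

/-- Total weight of a walk. -/
def walkWeight (G : Network V) {u v : V} (p : G.graph.Walk u v) : ℕ :=
  (p.edges.map G.weight).sum

/-- `d(u,v)`: the minimum total weight of a path from `u` to `v`. -/
noncomputable def dist (G : Network V) (u v : V) : ℕ :=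
  sInf {x | ∃ p : G.graph.Walk u v, p.IsPath ∧ G.walkWeight p = x}

/-- `h(u,v)`: the minimum number of edges of a simple path from `u` to `v` of total weight
`d(u,v)`. -/
noncomputable def hops (G : Network V) (u v : V) : ℕ :=
  sInf {l | ∃ p : G.graph.Walk u v, p.IsPath ∧ G.walkWeight p = G.dist u v ∧ p.length = l}

/-- The shortest-path diameter `S = max_{u,v} h(u,v)`. -/
noncomputable def spDiam [Fintype V] (G : Network V) : ℕ :=
  (Finset.univ : Finset (V × V)).sup fun x => G.hops x.1 x.2

/-- The number of edges `|E|`. -/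
noncomputable def numEdges (G : Network V) : ℕ := G.graph.edgeSet.ncard

/-- All identity numbers and all edge weights are polynomially bounded in the number of nodes,
with exponent `a`. -/
def PolyBounded [Fintype V] (G : Network V) (a : ℕ) : Prop :=
  (∀ v, G.ident v < Fintype.card V ^ a) ∧
    ∀ e ∈ G.graph.edgeSet, G.weight e ≤ Fintype.card V ^ a

/-- `v` is `ε`-far from `u`: at least `ε n` nodes are strictly closer to `u` than `v` is. -/
def Far [Fintype V] (G : Network V) (ε : ℝ) (u v : V) : Prop :=
  ε * (Fintype.card V : ℝ) ≤ (({w | G.dist u w < G.dist u v} : Set V).ncard : ℝ)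

/-- `R(u,ε)`: the infimum of the radii `r ≥ 0` for which the closed ball of radius `r` around `u`
contains at least `ε n` nodes. -/
noncomputable def densityRadius [Fintype V] (G : Network V) (u : V) (ε : ℝ) : ℝ :=
  sInf {r : ℝ | 0 ≤ r ∧
    ε * (Fintype.card V : ℝ) ≤ (({v | (G.dist u v : ℝ) ≤ r} : Set V).ncard : ℝ)}

/-- `N` is an `ε`-density net. -/
def IsDensityNet [Fintype V] (G : Network V) (ε : ℝ) (N : Set V) : Prop :=
  (∀ u, ∃ v ∈ N, (G.dist u v : ℝ) ≤ G.densityRadius u ε) ∧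
    (N.ncard : ℝ) ≤ 10 / ε * Real.log (Fintype.card V)

/-- `w` is a point of `A` at minimum distance from `u`. -/
def IsClosest (G : Network V) (A : Set V) (u w : V) : Prop :=
  w ∈ A ∧ ∀ y ∈ A, G.dist u w ≤ G.dist u y

/-- The `i`-th part `B_i(u) = {w ∈ A_i : d(u,w) < d(u,A_{i+1})}` of the bunch of `u` for a
hierarchy `A`; here `d(u,∅) = ∞`. -/
def bunch (G : Network V) (A : ℕ → Set V) (u : V) (i : ℕ) : Set V :=
  {w | w ∈ A i ∧ ∀ y ∈ A (i + 1), G.dist u w < G.dist u y}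

end Network

/-! ### Thorup-Zwick labels and CDG sketches as data -/

/-- The data of a Thorup-Zwick label with `k` levels: for every level, the pivot (if there is one)
and the list of bunch members, each recorded as a pair (identity, distance). -/
structure TZLabel (k : ℕ) where
  pivot : Fin k → Option (ℕ × ℕ)
  bunch : Fin k → List (ℕ × ℕ)

/-- The data of a CDG sketch: the identity of a net point, the distance to it, and a
Thorup-Zwick label. -/
structure CDGSketch (k : ℕ) where
  netPoint : ℕ
  netDist : ℕ
  label : TZLabel k

/-- Number of words of a label: on each level two words (identity, distance) for the pivot, one
word for the number of bunch members, and two words for every bunch member. -/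
def TZLabel.words {k : ℕ} (L : TZLabel k) : ℕ :=
  ∑ i, (2 + 1 + 2 * (L.bunch i).length)

/-- Number of words of a sketch. -/
def CDGSketch.words {k : ℕ} (s : CDGSketch k) : ℕ := 2 + s.label.words

/-- If the level-`i` pivot `p` of the first label (of `x`) is in the level-`i` bunch of the second
label (of `y`), this is `d(x,p) + d(y,p)`. -/
def TZLabel.via {k : ℕ} (L L' : TZLabel k) (i : Fin k) : Option ℕ :=
  (L.pivot i).bind fun p => ((L'.bunch i).lookup p.1).map fun x => p.2 + x

/-- The Thorup-Zwick estimate computed from two labels: at the first level `i` at which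
`p_i(x) ∈ B_i(y)` or `p_i(y) ∈ B_i(x)`, the sum of the distances of `x` and `y` to that pivot. -/
def TZLabel.estimate {k : ℕ} (L L' : TZLabel k) : Option ℕ :=
  (List.finRange k).findSome? fun i => (L.via L' i).or (L'.via L i)

/-- The estimate `d(u,u') + d''(u',v') + d(v',v)` computed from the sketches of `u` and `v`, where
`d''` is the Thorup-Zwick estimate. -/
def CDGSketch.estimate {k : ℕ} (s s' : CDGSketch k) : Option ℕ :=
  (s.label.estimate s'.label).map fun x => s.netDist + x + s'.netDist

namespace Network

variable {V : Type*}

/-- `L` is a Thorup-Zwick label of `u` for the hierarchy `A 0 ⊇ A 1 ⊇ ⋯ ⊇ A k = ∅`.  A pivot may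
be missing only on a level that is empty. -/
def IsTZLabel (G : Network V) {k : ℕ} (A : ℕ → Set V) (u : V) (L : TZLabel k) : Prop :=
  ∀ i : Fin k,
    ((A i = ∅ ∧ L.pivot i = none) ∨
      ∃ w, G.IsClosest (A i) u w ∧ L.pivot i = some (G.ident w, G.dist u w)) ∧
    (L.bunch i).Nodup ∧
    ∀ x, x ∈ L.bunch i ↔ ∃ w ∈ G.bunch A u i, x = (G.ident w, G.dist u w)

/-- `s` is a CDG sketch of `u` for the net `A 0` and the hierarchy `A` on it: the identity of a
closest net point `u'`, its distance from `u`, and the Thorup-Zwick label of `u'`. -/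
def IsCDGSketch (G : Network V) {k : ℕ} (A : ℕ → Set V) (u : V) (s : CDGSketch k) : Prop :=
  ∃ u', G.IsClosest (A 0) u u' ∧ s.netPoint = G.ident u' ∧ s.netDist = G.dist u u' ∧
    G.IsTZLabel A u' s.label

/-- The sketches have stretch `α` with `ε`-slack. -/
def HasStretchWithSlack [Fintype V] (G : Network V) {k : ℕ} (sk : V → CDGSketch k) (α ε : ℝ) :
    Prop :=
  ∀ u v, G.Far ε u v → ∃ x : ℕ, (sk u).estimate (sk v) = some x ∧
    G.dist u v ≤ x ∧ (x : ℝ) ≤ α * (G.dist u v : ℝ)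

end Network

/-! ### Private randomness and the random hierarchy -/

/-- The private random source of one node: a sequence of numbers in `[0,1]`. -/
abbrev Tape : Type := ℕ → unitInterval

/-- The joint law of the random sources of all nodes: all entries of all tapes are independent and
uniform on `[0,1]`. -/
noncomputable def tapeMeasure (V : Type*) [Fintype V] : Measure (V → Tape) :=
  Measure.pi fun _ => Measure.infinitePi fun _ : ℕ => (volume : Measure unitInterval)

/-- The random hierarchy of a CDG sketch.  Every node joins the net `A 0` independently with
probability `min(1, 5 ln n / (ε n))`; every node of `A i` joins `A (i+1)`, for `i + 1 < k`,
independently with probability `((10/ε) ln n)^(-1/k)`; and `A i = ∅` for `i ≥ k`. -/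
def sampledHierarchy {V : Type*} [Fintype V] (ε : ℝ) (k : ℕ) (ω : V → Tape) (i : ℕ) : Set V :=
  {v | i < k ∧
    (ω v 0 : ℝ) ≤ 5 * Real.log (Fintype.card V) / (ε * (Fintype.card V : ℝ)) ∧
    ∀ j < i, (ω v (j + 1) : ℝ) ≤ (10 / ε * Real.log (Fintype.card V)) ^ (-(1 / (k : ℝ)))}

/-! ### Synchronous message passing with bounded messages -/

/-- What a node knows at the beginning: its own identity number and, for every identity number,
whether this is the identity of a neighbour, and then the weight of the connecting edge. -/
structure LocalInput where
  ident : ℕ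
  nbr : ℕ → Option ℕ

/-- A randomized synchronous distributed algorithm with message alphabet of size `M` and output
type `O`.  All nodes run the same program; local computation is unrestricted.  Neighbours are
addressed by their identity numbers, `none` means that no message is sent (received), and a node
has halted as soon as `output` is not `none`. -/
structure DistAlg (M : ℕ) (O : Type) where
  State : Type
  init : LocalInput → Tape → State
  send : State → ℕ → Option (Fin M)
  receive : State → (ℕ → Option (Fin M)) → State
  output : State → Option O

open Classical in
/-- Reads a family indexed by the neighbours of `v` through their identity numbers. -/
noncomputable def Network.byIdent {V α : Type*} (G : Network V) (v : V) (f : V → Option α)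
    (j : ℕ) : Option α :=
  if h : ∃ w, G.graph.Adj v w ∧ G.ident w = j then f h.choose else none

/-- The initial knowledge of `v`. -/
noncomputable def Network.input {V : Type*} (G : Network V) (v : V) : LocalInput where
  ident := G.ident v
  nbr := G.byIdent v fun w => some (G.weight s(v, w))

namespace DistAlg

variable {V : Type*} {M : ℕ} {O : Type}

open Classical in
/-- The message sent from `v` to `w` in a round that starts with node states `s`; messages travel
along edges only, and a node that has halted is silent. -/
noncomputable def message (alg : DistAlg M O) (G : Network V) (s : V → alg.State) (v w : V) :
    Option (Fin M) :=
  if G.graph.Adj v w ∧ alg.output (s v) = none then alg.send (s v) (G.ident w) else none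

open Classical in
/-- The state of every node after `t` rounds; a node that has halted keeps its state. -/
noncomputable def state (alg : DistAlg M O) (G : Network V) (ω : V → Tape) :
    ℕ → V → alg.State
  | 0 => fun v => alg.init (G.input v) (ω v)
  | t + 1 => fun v =>
      if alg.output (alg.state G ω t v) = none then
        alg.receive (alg.state G ω t v)
          (G.byIdent v fun w => alg.message G (alg.state G ω t) w v)
      else alg.state G ω t v

/-- All nodes have halted after `R` rounds. -/
def HaltedBy (alg : DistAlg M O) (G : Network V) (ω : V → Tape) (R : ℕ) : Prop :=
  ∀ v, alg.output (alg.state G ω R v) ≠ none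

/-- The number of messages sent in the first `R` rounds. -/
noncomputable def messageCount [Fintype V] (alg : DistAlg M O) (G : Network V) (ω : V → Tape)
    (R : ℕ) : ℕ :=
  ∑ t ∈ Finset.range R, ∑ v, ∑ w, if (alg.message G (alg.state G ω t) v w).isSome then 1 else 0

/-- Node `v` halts with output `o`. -/
def Outputs (alg : DistAlg M O) (G : Network V) (ω : V → Tape) (v : V) (o : O) : Prop :=
  ∃ t, alg.output (alg.state G ω t v) = some o

end DistAlg

/-!
The theorem is proved by one algorithm in which all nodes compute hop-limited distances.  Let `r v`
be the number of sets of the random hierarchy that contain `v`.  After `t` steps a node `v` holds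
the entries `(r w, w, weight, length)` of all walks with at most `t` edges from `v` to sampled nodes
`w`, except those beaten by a walk to a node of higher level that is not farther away, or by a
better walk to the same node.  Beating is compatible with prepending an edge, so the table of the
next step is computed from the pruned tables of the neighbours (`Network.entries_eq`), and from step
`S` on the table is exactly the bunch of `v` with true distances (`Network.prune_walkEntries`); the
pivots are contained in it, too.  A linear extension of the beating order singles out the first
entry of a table, which belongs to a closest net point; its table is copied along a shortest path
(`Network.copy_eq_finalEntries`).  Hence nothing changes after `2 * S + 1` steps.

The nodes do not know `S`.  They also flood the least identity, and the last time at which any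
change is known to have happened.  If a node is still its own leader at time `t` and knows of no
change after time `c`, where `2 * c + 2 ≤ t`, then its identity has reached all nodes within `c`
steps, since the wave of this identity would have caused a later change, of which the node would
have heard by now.  So it has heard of all nodes at time `c + 1`, and the computation is at rest
(`Network.info_fixed_of_clock`).  Such a node halts; its silence makes its neighbours halt, and so
on.  A node whose table is too large to be sent halts as well.  So for every outcome of the random
choices everything ends after `5 * S + 4` steps (`all_done`), and if no table is ever too large, the
outcome is right (`output_nodeState`).  One step takes `2 * W + 2` rounds when tables have at most
`W` entries (`BroadcastAlg.state_compile`).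

It remains to bound the tables at all times `t < n`.  If `v` holds more than `B` entries of one
level, then the ball around `v`, with respect to the `t`-hop distance, that reaches to the farthest
of them contains more than `B` nodes of that level and none of the next one.  For a fixed ball this
has probability at most `(1 - p) ^ B`: give every node of the ball the weight `1` if it is not on
the level, `1 / (1 - p)` if it is on the level but is not promoted, and `0` if it is promoted; these
weights are independent with mean `1` (`tapeMeasure_no_promotion_le`).  Since
`k ≤ C * log (1 / ε)`, the probability `p` is at most `exp (-1 / C)`, so that only `O(log n)` levels
are nonempty and a union bound over times, balls and levels suffices; that is where `K` depends on
`C`.  The other requirements are exponential-moment bounds for the net and its covering property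
(`tapeMeasure_not_isDensityNet_le`).  The stretch is a consequence of the definitions
(`Network.hasStretchWithSlack`).
-/

/-! ### Broadcasting whole values in blocks of rounds -/

namespace Network

variable {V α : Type*}

lemma byIdent_congr (G : Network V) (v : V) {f g : V → Option α}
    (h : ∀ w, G.graph.Adj v w → f w = g w) : G.byIdent v f = G.byIdent v g := by
  funext j
  unfold byIdent
  split_ifs with hj
  · exact h _ hj.choose_spec.1
  · rfl

lemma byIdent_apply (G : Network V) {v w : V} (h : G.graph.Adj v w) (f : V → Option α) :
    G.byIdent v f (G.ident w) = f w := by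
  have hj : ∃ w', G.graph.Adj v w' ∧ G.ident w' = G.ident w := ⟨w, h, rfl⟩
  unfold byIdent
  rw [dif_pos hj, G.ident_injective hj.choose_spec.2]

lemma byIdent_of_not_exists (G : Network V) {v : V} {j : ℕ}
    (h : ¬ ∃ w, G.graph.Adj v w ∧ G.ident w = j) (f : V → Option α) :
    G.byIdent v f j = none := by
  unfold byIdent
  rw [dif_neg h]

lemma byIdent_eq_some_iff (G : Network V) {v : V} {j : ℕ} {f : V → Option α} {y : α} :
    G.byIdent v f j = some y ↔ ∃ w, G.graph.Adj v w ∧ G.ident w = j ∧ f w = some y := by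
  constructor
  · intro h
    by_cases hj : ∃ w, G.graph.Adj v w ∧ G.ident w = j
    · obtain ⟨w, hw, rfl⟩ := hj
      rw [G.byIdent_apply hw] at h
      exact ⟨w, hw, rfl, h⟩
    · rw [G.byIdent_of_not_exists hj] at h
      cases h
  · rintro ⟨w, hw, rfl, h⟩
    rw [G.byIdent_apply hw, h]

end Network

/-- A synchronous algorithm in which every node that has not halted announces one value of type
`P` to all its neighbours in every step.  A neighbour that has halted is heard as `none`. -/
structure BroadcastAlg (P O : Type) where
  State : Type
  init : LocalInput → Tape → State
  announce : State → P
  step : State → (ℕ → Option P) → State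
  output : State → Option O

namespace BroadcastAlg

variable {V : Type*} {P O : Type}

open Classical in
/-- The announcement of a node in state `σ`, if it has not halted. -/
noncomputable def heard (alg : BroadcastAlg P O) (σ : alg.State) : Option P :=
  if alg.output σ = none then some (alg.announce σ) else none

open Classical in
/-- The state of every node after `t` steps. -/
noncomputable def state (alg : BroadcastAlg P O) (G : Network V) (ω : V → Tape) :
    ℕ → V → alg.State
  | 0 => fun v => alg.init (G.input v) (ω v)
  | t + 1 => fun v =>
      if alg.output (alg.state G ω t v) = none then
        alg.step (alg.state G ω t v) (G.byIdent v fun w => alg.heard (alg.state G ω t w))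
      else alg.state G ω t v

open Classical in
lemma state_succ (alg : BroadcastAlg P O) (G : Network V) (ω : V → Tape) (t : ℕ) (v : V) :
    alg.state G ω (t + 1) v = if alg.output (alg.state G ω t v) = none then
        alg.step (alg.state G ω t v) (G.byIdent v fun w => alg.heard (alg.state G ω t w))
      else alg.state G ω t v := rfl

open Classical in
/-- The value that neighbour `j` has announced in a block of `L` rounds, read off from the messages
`buf s j` received in the rounds `s` of the block; `none` if a message is missing. -/
noncomputable def assemble {L M : ℕ} (decode : (Fin L → Fin M) → P)
    (buf : ℕ → ℕ → Option (Fin M)) (j : ℕ) : Option P :=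
  if h : ∃ x : Fin L → Fin M, ∀ s : Fin L, buf s j = some (x s) then some (decode h.choose)
  else none

/-- The message-passing algorithm that spends `L` rounds on every step of a broadcast algorithm: in
round `s` of the block every node sends the `s`-th letter of the code word of its announcement. -/
noncomputable abbrev compile (alg : BroadcastAlg P O) {L M : ℕ} (code : P → Fin L → Fin M)
    (decode : (Fin L → Fin M) → P) : DistAlg M O where
  State := alg.State × ℕ × (ℕ → ℕ → Option (Fin M))
  init i τ := (alg.init i τ, 0, fun _ _ => none)
  send σ _ := if h : σ.2.1 < L then some (code (alg.announce σ.1) ⟨σ.2.1, h⟩) else none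
  receive σ m :=
    if σ.2.1 + 1 < L then (σ.1, σ.2.1 + 1, Function.update σ.2.2 σ.2.1 m)
    else (alg.step σ.1 (assemble decode (Function.update σ.2.2 σ.2.1 m)), 0, fun _ _ => none)
  output σ := alg.output σ.1

section

variable (alg : BroadcastAlg P O) {L M : ℕ} (code : P → Fin L → Fin M)
  (decode : (Fin L → Fin M) → P) (G : Network V) (ω : V → Tape)

/-- The messages that `v` receives in round `s` of block `t`. -/
noncomputable def blockMsg (t s : ℕ) (v : V) : ℕ → Option (Fin M) :=
  G.byIdent v fun w => (alg.heard (alg.state G ω t w)).bind fun p =>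
    if h : s < L then some (code p ⟨s, h⟩) else none

open Classical in
/-- The state of `v` in the compiled algorithm after `s` rounds of block `t`. -/
noncomputable def blockState (t s : ℕ) (v : V) : alg.State × ℕ × (ℕ → ℕ → Option (Fin M)) :=
  if alg.output (alg.state G ω t v) = none then
    (alg.state G ω t v, s, fun s' => if s' < s then alg.blockMsg code G ω t s' v else fun _ => none)
  else (alg.state G ω t v, 0, fun _ _ => none)

lemma blockState_zero (t : ℕ) (v : V) :
    alg.blockState code G ω t 0 v = (alg.state G ω t v, 0, fun _ _ => none) := by
  unfold blockState
  split_ifs <;> simp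

lemma fst_blockState (t s : ℕ) (v : V) :
    (alg.blockState code G ω t s v).1 = alg.state G ω t v := by
  unfold blockState
  split_ifs <;> rfl

lemma message_compile (t s : ℕ) (v : V) :
    (G.byIdent v fun w => (alg.compile code decode).message G (alg.blockState code G ω t s) w v) =
      alg.blockMsg code G ω t s v := by
  apply G.byIdent_congr
  intro w hw
  unfold DistAlg.message heard
  by_cases h : alg.output (alg.state G ω t w) = none
  · have h' : (alg.compile code decode).output (alg.blockState code G ω t s w) = none := by
      change alg.output (alg.blockState code G ω t s w).1 = none
      rw [fst_blockState, h]
    rw [if_pos ⟨hw.symm, h'⟩, if_pos h]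
    have h2 : (alg.blockState code G ω t s w).2.1 = s := by
      unfold blockState
      rw [if_pos h]
    simp only [h2, fst_blockState, Option.bind_some]
  · have h' : ¬ (alg.compile code decode).output (alg.blockState code G ω t s w) = none := by
      change ¬ alg.output (alg.blockState code G ω t s w).1 = none
      rwa [fst_blockState]
    rw [if_neg (fun h => h' h.2), if_neg h, Option.bind_none]

variable {code decode}

lemma assemble_blockMsg
    (hdec : ∀ σ, alg.output σ = none → decode (code (alg.announce σ)) = alg.announce σ)
    (hL : 0 < L) (t : ℕ) (v : V) (buf : ℕ → ℕ → Option (Fin M))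
    (hbuf : ∀ s < L, buf s = alg.blockMsg code G ω t s v) :
    assemble decode buf = G.byIdent v fun w => alg.heard (alg.state G ω t w) := by
  funext j
  by_cases hj : ∃ w, G.graph.Adj v w ∧ G.ident w = j
  · obtain ⟨w, hw, rfl⟩ := hj
    rw [G.byIdent_apply hw]
    have hb : ∀ s : Fin L, buf s (G.ident w) = (alg.heard (alg.state G ω t w)).bind fun p =>
        some (code p s) := by
      intro s
      rw [hbuf s s.2, blockMsg, G.byIdent_apply hw]
      simp
    unfold assemble
    by_cases h : alg.output (alg.state G ω t w) = none
    · have hh : alg.heard (alg.state G ω t w) = some (alg.announce (alg.state G ω t w)) := by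
        unfold heard; rw [if_pos h]
      simp only [hh, Option.bind_some] at hb
      have hex : ∃ x : Fin L → Fin M, ∀ s : Fin L, buf s (G.ident w) = some (x s) := ⟨_, hb⟩
      rw [dif_pos hex, hh]
      have : hex.choose = code (alg.announce (alg.state G ω t w)) := by
        funext s
        have h1 := hex.choose_spec s
        rw [hb s] at h1
        exact (Option.some.inj h1).symm
      rw [this, hdec _ h]
    · have hh : alg.heard (alg.state G ω t w) = none := by
        unfold heard; rw [if_neg h]
      simp only [hh, Option.bind_none] at hb
      rw [dif_neg, hh]
      rintro ⟨x, hx⟩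
      have := hx ⟨0, hL⟩
      rw [hb] at this
      cases this
  · rw [G.byIdent_of_not_exists hj]
    unfold assemble
    rw [dif_neg]
    rintro ⟨x, hx⟩
    have := hx ⟨0, hL⟩
    rw [hbuf _ hL, blockMsg, G.byIdent_of_not_exists hj] at this
    cases this

/-- The compiled algorithm simulates the broadcast algorithm, provided that the code recovers the
announcements of the nodes that have not halted. -/
lemma state_compile
    (hdec : ∀ σ, alg.output σ = none → decode (code (alg.announce σ)) = alg.announce σ)
    (t s : ℕ) (hs : s < L) :
    (alg.compile code decode).state G ω (t * L + s) = alg.blockState code G ω t s := by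
  have hL : 0 < L := by omega
  have next : ∀ t s, s < L →
      (alg.compile code decode).state G ω (t * L + s) = alg.blockState code G ω t s →
      (alg.compile code decode).state G ω (t * L + s + 1) =
        if s + 1 < L then alg.blockState code G ω t (s + 1)
        else alg.blockState code G ω (t + 1) 0 := by
    intro t s hs ih
    funext v
    rw [DistAlg.state, ih]
    beta_reduce
    rw [message_compile]
    have ho : (alg.compile code decode).output (alg.blockState code G ω t s v) =
        alg.output (alg.state G ω t v) := by
      change alg.output (alg.blockState code G ω t s v).1 = _
      rw [fst_blockState]
    rw [ho]
    by_cases h : alg.output (alg.state G ω t v) = none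
    · rw [if_pos h]
      have hupd : Function.update (fun s' => if s' < s then alg.blockMsg code G ω t s' v
            else fun _ => none) s (alg.blockMsg code G ω t s v) =
          fun s' => if s' < s + 1 then alg.blockMsg code G ω t s' v else fun _ => none := by
        funext s'
        by_cases h1 : s' = s
        · subst h1; simp
        · rw [Function.update_of_ne h1]
          by_cases h2 : s' < s
          · rw [if_pos h2, if_pos (by omega)]
          · rw [if_neg h2, if_neg (by omega)]
      have hb : alg.blockState code G ω t s v = (alg.state G ω t v, s, fun s' =>
          if s' < s then alg.blockMsg code G ω t s' v else fun _ => none) := by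
        unfold blockState; rw [if_pos h]
      rw [hb]
      simp only [compile]
      rw [hupd]
      by_cases h3 : s + 1 < L
      · rw [if_pos h3, if_pos h3, blockState, if_pos h]
      · rw [if_neg h3, if_neg h3, blockState_zero,
          assemble_blockMsg alg G ω hdec hL t v _ (fun s' hs' => if_pos (by omega)), state_succ, if_pos h]
    · rw [if_neg h]
      split_ifs with h3
      · simp only [blockState, if_neg h]
      · rw [blockState_zero, state_succ, if_neg h, blockState, if_neg h]
  induction t generalizing s with
  | zero =>
    induction s with
    | zero =>
      funext v
      rw [blockState_zero]
      simp [DistAlg.state, state, compile]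
    | succ s ih =>
      have := next 0 s (by omega) (ih (by omega))
      rwa [if_pos hs] at this
  | succ t iht =>
    induction s with
    | zero =>
      have := next t (L - 1) (by omega) (iht _ (by omega))
      rw [if_neg (by omega)] at this
      rw [← this]
      congr 1
      rw [Nat.succ_mul]; omega
    | succ s ih =>
      have := next (t + 1) s (by omega) (ih (by omega))
      rwa [if_pos hs] at this

lemma output_compile
    (hdec : ∀ σ, alg.output σ = none → decode (code (alg.announce σ)) = alg.announce σ)
    (hL : 0 < L) (t : ℕ) (v : V) :
    (alg.compile code decode).output ((alg.compile code decode).state G ω (t * L) v) =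
      alg.output (alg.state G ω t v) := by
  have := alg.state_compile G ω hdec t 0 hL
  rw [Nat.add_zero] at this
  rw [this]
  change alg.output (alg.blockState code G ω t 0 v).1 = _
  rw [fst_blockState]

end

end BroadcastAlg

open Classical in
/-- At most one message per round crosses an edge in each direction. -/
lemma DistAlg.messageCount_le {V : Type*} {O : Type} [Fintype V] {M : ℕ} (alg : DistAlg M O)
    (G : Network V) (ω : V → Tape) (R : ℕ) :
    alg.messageCount G ω R ≤ R * (2 * G.numEdges) := by
  have hE : G.numEdges = G.graph.edgeFinset.card := by
    unfold Network.numEdges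
    rw [← SimpleGraph.coe_edgeFinset, Set.ncard_coe_finset]
  have : ∀ t, (∑ v, ∑ w, if (alg.message G (alg.state G ω t) v w).isSome then 1 else 0) ≤
      2 * G.numEdges := by
    intro t
    rw [hE, ← SimpleGraph.sum_degrees_eq_twice_card_edges]
    refine Finset.sum_le_sum fun v _ => ?_
    rw [← SimpleGraph.card_neighborFinset_eq_degree, Finset.card_eq_sum_ones,
      SimpleGraph.neighborFinset_eq_filter, Finset.sum_filter]
    refine Finset.sum_le_sum fun w _ => ?_
    unfold DistAlg.message
    by_cases h : G.graph.Adj v w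
    · rw [if_pos h]; split_ifs <;> simp
    · simp [h]
  unfold messageCount
  calc _ ≤ ∑ t ∈ Finset.range R, 2 * G.numEdges := Finset.sum_le_sum fun t _ => this t
    _ = _ := by simp

/-! ### Shortest-path distances and hop counts -/

namespace Network

variable {V : Type*} (G : Network V)

@[simp]
lemma walkWeight_nil (u : V) : G.walkWeight (SimpleGraph.Walk.nil : G.graph.Walk u u) = 0 := rfl

@[simp]
lemma walkWeight_cons {u v w : V} (h : G.graph.Adj u v) (p : G.graph.Walk v w) :
    G.walkWeight (SimpleGraph.Walk.cons h p) = G.weight s(u, v) + G.walkWeight p := by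
  simp [walkWeight]

lemma walkWeight_reverse {u v : V} (p : G.graph.Walk u v) :
    G.walkWeight p.reverse = G.walkWeight p := by
  simp [walkWeight, List.map_reverse, List.sum_reverse]

lemma walkWeight_append {u v w : V} (p : G.graph.Walk u v) (q : G.graph.Walk v w) :
    G.walkWeight (p.append q) = G.walkWeight p + G.walkWeight q := by
  simp [walkWeight, SimpleGraph.Walk.edges_append]

/-- Shortcutting a walk to a path increases neither the weight nor the number of edges. -/
lemma exists_isPath_le {u v : V} (p : G.graph.Walk u v) :
    ∃ q : G.graph.Walk u v, q.IsPath ∧ G.walkWeight q ≤ G.walkWeight p ∧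
      q.length ≤ p.length := by
  classical
  refine ⟨p.bypass, p.bypass_isPath, ?_, p.length_bypass_le_length⟩
  exact ((p.edges_bypass_sublist_edges).map G.weight).sum_le_sum fun _ _ => Nat.zero_le _

lemma dist_le_walkWeight {u v : V} (p : G.graph.Walk u v) : G.dist u v ≤ G.walkWeight p := by
  obtain ⟨q, hq, hle, -⟩ := G.exists_isPath_le p
  exact le_trans (Nat.sInf_le ⟨q, hq, rfl⟩) hle

lemma exists_isPath_dist_hops (u v : V) : ∃ p : G.graph.Walk u v, p.IsPath ∧
    G.walkWeight p = G.dist u v ∧ p.length = G.hops u v := by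
  have h1 : {x | ∃ p : G.graph.Walk u v, p.IsPath ∧ G.walkWeight p = x}.Nonempty := by
    obtain ⟨p⟩ := G.connected.preconnected u v
    obtain ⟨q, hq, -⟩ := G.exists_isPath_le p
    exact ⟨_, q, hq, rfl⟩
  obtain ⟨p, hp, hpd⟩ := Nat.sInf_mem h1
  have h2 : {l | ∃ p : G.graph.Walk u v, p.IsPath ∧ G.walkWeight p = G.dist u v ∧
      p.length = l}.Nonempty := ⟨_, p, hp, hpd, rfl⟩
  exact Nat.sInf_mem h2

lemma hops_le_length {u v : V} (p : G.graph.Walk u v) (hp : G.walkWeight p = G.dist u v) :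
    G.hops u v ≤ p.length := by
  obtain ⟨q, hq, hle, hlen⟩ := G.exists_isPath_le p
  refine le_trans (Nat.sInf_le ?_) hlen
  exact ⟨q, hq, le_antisymm (hle.trans hp.le) (G.dist_le_walkWeight q), rfl⟩

@[simp]
lemma dist_self (u : V) : G.dist u u = 0 :=
  Nat.le_zero.1 (G.dist_le_walkWeight SimpleGraph.Walk.nil)

lemma dist_comm (u v : V) : G.dist u v = G.dist v u := by
  have key : ∀ u v : V, G.dist u v ≤ G.dist v u := by
    intro u v
    obtain ⟨p, -, hp, -⟩ := G.exists_isPath_dist_hops v u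
    rw [← hp, ← G.walkWeight_reverse]
    exact G.dist_le_walkWeight _
  exact le_antisymm (key u v) (key v u)

lemma dist_triangle (u v w : V) : G.dist u w ≤ G.dist u v + G.dist v w := by
  obtain ⟨p, -, hp, -⟩ := G.exists_isPath_dist_hops u v
  obtain ⟨q, -, hq, -⟩ := G.exists_isPath_dist_hops v w
  rw [← hp, ← hq, ← G.walkWeight_append]
  exact G.dist_le_walkWeight _

section Fintype

variable [Fintype V]

lemma hops_le_spDiam (u v : V) : G.hops u v ≤ G.spDiam :=
  Finset.le_sup (f := fun x : V × V => G.hops x.1 x.2) (Finset.mem_univ (u, v))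

lemma spDiam_lt_card [Nonempty V] : G.spDiam < Fintype.card V := by
  refine (Finset.sup_lt_iff (Fintype.card_pos)).2 fun x _ => ?_
  obtain ⟨p, hp, -, hl⟩ := G.exists_isPath_dist_hops x.1 x.2
  rw [← hl]
  exact hp.length_lt

lemma one_le_spDiam (h : 2 ≤ Fintype.card V) : 1 ≤ G.spDiam := by
  obtain ⟨u, v, huv⟩ := Fintype.exists_pair_of_one_lt_card h
  refine le_trans ?_ (G.hops_le_spDiam u v)
  obtain ⟨p, -, -, hl⟩ := G.exists_isPath_dist_hops u v
  rw [← hl]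
  by_contra h0
  exact huv (SimpleGraph.Walk.eq_of_length_eq_zero (p := p) (by omega))

lemma exists_walk_length_le_spDiam (u v : V) :
    ∃ p : G.graph.Walk u v, p.length ≤ G.spDiam := by
  obtain ⟨p, -, -, hl⟩ := G.exists_isPath_dist_hops u v
  exact ⟨p, hl ▸ G.hops_le_spDiam u v⟩

lemma walkWeight_le_of_polyBounded {a : ℕ} (hG : G.PolyBounded a) {u v : V}
    (p : G.graph.Walk u v) : G.walkWeight p ≤ p.length * Fintype.card V ^ a := by
  induction p with
  | nil => simp
  | cons h p ih =>
    rw [walkWeight_cons, SimpleGraph.Walk.length_cons, Nat.succ_mul]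
    have := hG.2 _ ((SimpleGraph.mem_edgeSet _).2 h)
    omega

end Fintype

/-! ### The stretch of Thorup-Zwick labels and of CDG sketches -/

/-- Looking up an identity in a list of (identity, value) pairs of the members of a set. -/
lemma lookup_ident {l : List (ℕ × ℕ)} {S : Set V} {f : V → ℕ}
    (hl : ∀ x, x ∈ l ↔ ∃ w ∈ S, x = (G.ident w, f w)) (w : V) (z : ℕ) :
    l.lookup (G.ident w) = some z ↔ w ∈ S ∧ z = f w := by
  have key : ∀ l : List (ℕ × ℕ), (∀ x ∈ l, ∃ w ∈ S, x = (G.ident w, f w)) →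
      ∀ z, l.lookup (G.ident w) = some z → w ∈ S ∧ z = f w := by
    intro l
    induction l with
    | nil => intro _ z hz; simp at hz
    | cons x l ih =>
      intro h z hz
      obtain ⟨w', hw', rfl⟩ := h x (by simp)
      by_cases hww : w = w'
      · subst hww
        simp at hz
        exact ⟨hw', hz.symm⟩
      · have : (G.ident w == G.ident w') = false := by
          simpa using fun h => hww (G.ident_injective h)
        rw [List.lookup_cons, this] at hz
        exact ih (fun x hx => h x (by simp [hx])) z hz
  constructor
  · exact key l (fun x hx => (hl x).1 hx) z
  · rintro ⟨hw, rfl⟩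
    have hmem : (G.ident w, f w) ∈ l := (hl _).2 ⟨w, hw, rfl⟩
    cases h : l.lookup (G.ident w) with
    | none =>
      rw [List.lookup_eq_none_iff] at h
      have := h _ hmem
      simp at this
    | some z => rw [(key l (fun x hx => (hl x).1 hx) z h).2]

variable {G}

lemma IsTZLabel.via_eq_some {k : ℕ} {A : ℕ → Set V} {x y : V} {Lx Ly : TZLabel k}
    (hx : G.IsTZLabel A x Lx) (hy : G.IsTZLabel A y Ly) {i : Fin k} {z : ℕ} :
    Lx.via Ly i = some z → ∃ p, G.IsClosest (A i) x p ∧ p ∈ G.bunch A y i ∧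
      z = G.dist x p + G.dist y p := by
  intro h
  obtain ⟨-, h0⟩ | ⟨p, hp, h0⟩ := (hx i).1
  · simp [TZLabel.via, h0] at h
  · simp only [TZLabel.via, h0, Option.bind_some, Option.map_eq_some_iff] at h
    obtain ⟨z', hz', rfl⟩ := h
    obtain ⟨hm, rfl⟩ := (G.lookup_ident (hy i).2.2 p z').1 hz'
    exact ⟨p, hp, hm, rfl⟩

lemma IsTZLabel.via_eq_none {k : ℕ} {A : ℕ → Set V} {x y : V} {Lx Ly : TZLabel k}
    (hx : G.IsTZLabel A x Lx) (hy : G.IsTZLabel A y Ly) {i : Fin k} (hA : (A i).Nonempty)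
    (h : Lx.via Ly i = none) :
    ∃ p, G.IsClosest (A i) x p ∧ ∃ q ∈ A (i + 1), G.dist y q ≤ G.dist y p := by
  obtain ⟨h1, -⟩ | ⟨p, hp, h0⟩ := (hx i).1
  · exact absurd h1 hA.ne_empty
  · refine ⟨p, hp, ?_⟩
    by_contra hcon
    push Not at hcon
    have hm : p ∈ G.bunch A y i := ⟨hp.1, fun q hq => hcon q hq⟩
    have := (G.lookup_ident (hy i).2.2 p _).2 ⟨hm, rfl⟩
    simp [TZLabel.via, h0, this] at h

/-- If no pivot of a level below `i` lies in the other bunch, then the level `i` is nonempty and its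
pivots are at distance at most `i * d(x,y)`. -/
lemma IsTZLabel.dist_pivot_le {k : ℕ} {A : ℕ → Set V} {x y : V} {Lx Ly : TZLabel k}
    (hx : G.IsTZLabel A x Lx) (hy : G.IsTZLabel A y Ly) (hx0 : x ∈ A 0) (hy0 : y ∈ A 0) (i : ℕ)
    (hik : i ≤ k)
    (h : ∀ j : Fin k, (j : ℕ) < i → Lx.via Ly j = none ∧ Ly.via Lx j = none) :
    (∃ p ∈ A i, G.dist x p ≤ i * G.dist x y) ∧ ∃ p ∈ A i, G.dist y p ≤ i * G.dist x y := by
  induction i with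
  | zero => exact ⟨⟨x, hx0, by simp⟩, y, hy0, by simp⟩
  | succ i ih =>
    obtain ⟨⟨px, hpx, hpxd⟩, py, hpy, hpyd⟩ := ih (by omega) fun j hj => h j (by omega)
    obtain ⟨h1, h2⟩ := h ⟨i, by omega⟩ (by simp)
    obtain ⟨p, hp, q, hq, hqd⟩ := hx.via_eq_none hy ⟨px, hpx⟩ h1
    obtain ⟨p', hp', q', hq', hqd'⟩ := hy.via_eq_none hx ⟨px, hpx⟩ h2
    have e1 := hp.2 px hpx
    have e2 := hp'.2 py hpy
    have e3 := G.dist_triangle y x p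
    have e4 := G.dist_triangle x y p'
    have e5 := G.dist_comm y x
    refine ⟨⟨q', hq', ?_⟩, q, hq, ?_⟩ <;> rw [Nat.succ_mul] <;> omega

/-- Thorup-Zwick labels of two points of `A 0` have stretch `2 * k - 1`. -/
lemma IsTZLabel.estimate_le {k : ℕ} {A : ℕ → Set V} {x y : V} {Lx Ly : TZLabel k}
    (hx : G.IsTZLabel A x Lx) (hy : G.IsTZLabel A y Ly) (hx0 : x ∈ A 0) (hy0 : y ∈ A 0)
    (hk : A k = ∅) :
    ∃ z, Lx.estimate Ly = some z ∧ G.dist x y ≤ z ∧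
      z + G.dist x y ≤ 2 * k * G.dist x y := by
  unfold TZLabel.estimate
  cases hz : (List.finRange k).findSome? fun i => (Lx.via Ly i).or (Ly.via Lx i) with
  | none =>
    rw [List.findSome?_eq_none_iff] at hz
    obtain ⟨⟨p, hp, -⟩, -⟩ := hx.dist_pivot_le hy hx0 hy0 k le_rfl fun j _ =>
      Option.or_eq_none_iff.1 (hz j (List.mem_finRange j))
    rw [hk] at hp
    exact hp.elim
  | some z =>
    refine ⟨z, rfl, ?_⟩
    rw [List.findSome?_eq_some_iff] at hz
    obtain ⟨l₁, i, l₂, hl, hi, hl₁⟩ := hz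
    have hfirst : ∀ j : Fin k, (j : ℕ) < i → Lx.via Ly j = none ∧ Ly.via Lx j = none := by
      intro j hj
      have hmem : j ∈ l₁ ++ i :: l₂ := hl ▸ List.mem_finRange j
      have hsort := List.pairwise_lt_finRange k
      rw [hl, List.pairwise_append, List.pairwise_cons] at hsort
      rw [List.mem_append, List.mem_cons] at hmem
      rcases hmem with hmem | rfl | hmem
      · exact Option.or_eq_none_iff.1 (hl₁ j hmem)
      · omega
      · have := hsort.2.1.1 j hmem
        rw [Fin.lt_def] at this
        omega
    obtain ⟨⟨px, hpx, hpxd⟩, py, hpy, hpyd⟩ := hx.dist_pivot_le hy hx0 hy0 i i.2.le hfirst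
    have e5 := G.dist_comm y x
    have e6 : (i + 1) * G.dist x y ≤ k * G.dist x y := Nat.mul_le_mul_right _ i.2
    rw [Nat.succ_mul] at e6
    rw [Nat.mul_assoc]
    rcases Option.or_eq_some_iff.1 hi with h | ⟨-, h⟩
    · obtain ⟨p, hp, -, rfl⟩ := hx.via_eq_some hy h
      have e1 := hp.2 px hpx
      have e3 := G.dist_triangle y x p
      have e4 := G.dist_triangle x p y
      have e7 := G.dist_comm p y
      omega
    · obtain ⟨p, hp, -, rfl⟩ := hy.via_eq_some hx h
      have e1 := hp.2 py hpy
      have e3 := G.dist_triangle x y p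
      have e4 := G.dist_triangle x p y
      have e7 := G.dist_comm p y
      omega

lemma Far.densityRadius_le [Fintype V] {ε : ℝ} {u v : V} (h : G.Far ε u v) :
    G.densityRadius u ε ≤ G.dist u v := by
  refine csInf_le ⟨0, fun r hr => hr.1⟩ ⟨Nat.cast_nonneg _, h.trans ?_⟩
  refine Nat.cast_le.2 (Set.ncard_le_ncard (fun w hw => ?_) (Set.toFinite _))
  exact (Nat.cast_le (α := ℝ)).2 (le_of_lt hw)

/-- Going through the nearest net points `u'` and `v'` costs `d(u,u') ≤ d`, `d(v,v') ≤ 2 d` and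
`d(u',v') ≤ 4 d`, where `d = d(u,v)`. -/
lemma hasStretchWithSlack [Fintype V] {k : ℕ} {A : ℕ → Set V} {ε : ℝ}
    {sk : V → CDGSketch k} (hsk : ∀ u, G.IsCDGSketch A u (sk u))
    (hnet : G.IsDensityNet ε (A 0)) (hk : A k = ∅) :
    G.HasStretchWithSlack sk (8 * k - 1) ε := by
  intro u v hfar
  obtain ⟨u', hu', -, hud, hul⟩ := hsk u
  obtain ⟨v', hv', -, hvd, hvl⟩ := hsk v
  obtain ⟨z, hz, hz1, hz2⟩ := hul.estimate_le hvl hu'.1 hv'.1 hk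
  obtain ⟨w, hw, hwd⟩ := hnet.1 u
  have hwd' : G.dist u w ≤ G.dist u v := by exact_mod_cast hwd.trans hfar.densityRadius_le
  refine ⟨_, by rw [CDGSketch.estimate, hz, Option.map_some], ?_⟩
  rw [hud, hvd]
  have e1 := hu'.2 w hw
  have e2 := hv'.2 u' hu'.1
  have e3 := G.dist_triangle v u u'
  have e4 := G.dist_comm v u
  have e5 := G.dist_triangle u' u v'
  have e6 := G.dist_triangle u v v'
  have e7 := G.dist_comm u' u
  have e8 := G.dist_triangle u u' v
  have e9 := G.dist_triangle u' v' v
  have e10 := G.dist_comm v' v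
  have e11 : 2 * k * G.dist u' v' ≤ 2 * k * (4 * G.dist u v) :=
    Nat.mul_le_mul_left _ (by omega)
  have e12 : 2 * k * (4 * G.dist u v) = 8 * (k * G.dist u v) := by ring
  refine ⟨by omega, ?_⟩
  have hk1 : 1 ≤ k := by
    by_contra h0
    have : k = 0 := by omega
    subst this
    rw [hk] at hw
    exact hw
  have key : G.dist u u' + z + G.dist v v' + G.dist u v ≤ 8 * (k * G.dist u v) := by
    -- the factor `2 * k - 1` is monotone in `d(u',v')`
    have e13 : (2 * k - 1) * G.dist u' v' ≤ (2 * k - 1) * (4 * G.dist u v) :=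
      Nat.mul_le_mul_left _ (by omega)
    have e14 : (2 * k - 1) * G.dist u' v' + G.dist u' v' = 2 * k * G.dist u' v' := by
      rw [← Nat.succ_mul]; congr 1; omega
    have e15 : (2 * k - 1) * (4 * G.dist u v) + 4 * G.dist u v = 2 * k * (4 * G.dist u v) := by
      rw [← Nat.succ_mul]; congr 1; omega
    omega
  have key' : ((G.dist u u' + z + G.dist v v' : ℕ) : ℝ) + G.dist u v ≤ 8 * (k * G.dist u v) := by
    exact_mod_cast key
  linarith

end Network

/-! ### Entries of distance tables -/

/-- A record of a source node: the number `lev` of sets of the hierarchy that contain the source,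
its identity, and the weight and the number of edges of a walk to it. -/
@[ext]
structure Entry where
  lev : ℕ
  id : ℕ
  dist : ℕ
  hop : ℕ

namespace Entry

/-- The record of a walk that is extended at its start by an edge of weight `c`. -/
def shift (e : Entry) (c : ℕ) : Entry := ⟨e.lev, e.id, c + e.dist, e.hop + 1⟩

/-- `e'` makes `e` superfluous: it records a source of a higher level that is not farther away, or a
walk to the same source that is lighter or has the same weight and fewer edges. -/
def Beats (e' e : Entry) : Prop :=
  (e.lev < e'.lev ∧ e'.dist ≤ e.dist) ∨
    (e'.lev = e.lev ∧ e'.id = e.id ∧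
      (e'.dist < e.dist ∨ (e'.dist = e.dist ∧ e'.hop < e.hop)))

/-- A linear order that extends `Beats`: by distance, then by decreasing level, then by the number
of edges, then by identity. -/
def Precedes (e' e : Entry) : Prop :=
  e'.dist < e.dist ∨ (e'.dist = e.dist ∧ (e.lev < e'.lev ∨ (e'.lev = e.lev ∧
    (e'.hop < e.hop ∨ (e'.hop = e.hop ∧ e'.id ≤ e.id)))))

lemma beats_mk {l x y h l' x' y' h' : ℕ} :
    Beats ⟨l', x', y', h'⟩ ⟨l, x, y, h⟩ ↔ (l < l' ∧ y' ≤ y) ∨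
      (l' = l ∧ x' = x ∧ (y' < y ∨ (y' = y ∧ h' < h))) := Iff.rfl

lemma Beats.trans {a b c : Entry} (h : a.Beats b) (h' : b.Beats c) : a.Beats c := by
  unfold Beats at *; omega

lemma Beats.precedes {a b : Entry} (h : a.Beats b) : a.Precedes b := by
  unfold Beats at h; unfold Precedes; omega

lemma Beats.not_precedes {a b : Entry} (h : a.Beats b) : ¬ b.Precedes a := by
  unfold Beats at h; unfold Precedes; omega

lemma Beats.shift {a b : Entry} (h : a.Beats b) (c : ℕ) : (a.shift c).Beats (b.shift c) := by
  unfold Beats Entry.shift at *; simp only at *; omega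

lemma Precedes.shift {a b : Entry} (h : a.Precedes b) (c : ℕ) :
    (a.shift c).Precedes (b.shift c) := by
  unfold Precedes Entry.shift at *; simp only at *; omega

lemma Precedes.refl (a : Entry) : a.Precedes a := by unfold Precedes; omega

lemma Precedes.trans {a b c : Entry} (h : a.Precedes b) (h' : b.Precedes c) : a.Precedes c := by
  unfold Precedes at *; omega

lemma Precedes.total (a b : Entry) : a.Precedes b ∨ b.Precedes a := by
  unfold Precedes at *; omega

lemma Precedes.antisymm {a b : Entry} (h : a.Precedes b) (h' : b.Precedes a) : a = b := by
  unfold Precedes at *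
  ext <;> omega

end Entry

/-- `m` is the first entry of `S` in the order `Entry.Precedes`. -/
def IsFirst (S : Set Entry) (m : Entry) : Prop := m ∈ S ∧ ∀ e ∈ S, m.Precedes e

lemma IsFirst.unique {S : Set Entry} {m m' : Entry} (h : IsFirst S m) (h' : IsFirst S m') : m = m' :=
  (h.2 _ h'.1).antisymm (h'.2 _ h.1)

lemma exists_isFirst {S : Set Entry} (hS : S.Finite) (hne : S.Nonempty) : ∃ m, IsFirst S m := by
  induction S, hS using Set.Finite.induction_on with
  | empty => exact absurd hne Set.not_nonempty_empty
  | @insert a S _ _ ih =>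
    rcases S.eq_empty_or_nonempty with rfl | h
    · refine ⟨a, by simp, fun e he => ?_⟩
      obtain rfl : e = a := by simpa using he
      exact Entry.Precedes.refl _
    · obtain ⟨m, hm, hmin⟩ := ih h
      rcases Entry.Precedes.total a m with ham | hma
      · refine ⟨a, by simp, fun e he => ?_⟩
        rcases he with rfl | he
        · exact Entry.Precedes.refl _
        · exact ham.trans (hmin e he)
      · refine ⟨m, by simp [hm], fun e he => ?_⟩
        rcases he with rfl | he
        · exact hma
        · exact hmin e he

/-- The entries of `S` that are not superfluous. -/
def prune (S : Set Entry) : Set Entry := {e | e ∈ S ∧ ∀ e' ∈ S, ¬ e'.Beats e}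

lemma prune_subset (S : Set Entry) : prune S ⊆ S := fun _ h => h.1

/-- A finite set of entries is dominated by its pruned part. -/
lemma exists_mem_prune {S : Set Entry} (hS : S.Finite) {e : Entry} (he : e ∈ S) :
    ∃ e' ∈ prune S, e' = e ∨ e'.Beats e := by
  obtain ⟨m, hm, hmin⟩ := exists_isFirst (S := {e' | e' ∈ S ∧ (e' = e ∨ e'.Beats e)})
    (hS.subset fun _ h => h.1) ⟨e, he, Or.inl rfl⟩
  refine ⟨m, ⟨hm.1, fun e' he' hb => ?_⟩, hm.2⟩
  refine hb.not_precedes (hmin e' ⟨he', Or.inr ?_⟩)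
  rcases hm.2 with rfl | h
  · exact hb
  · exact hb.trans h

/-- A subset that dominates has the same pruned part. -/
lemma prune_eq_of_dominates {T U : Set Entry} (hTU : T ⊆ U)
    (h : ∀ e ∈ U, ∃ e' ∈ T, e' = e ∨ e'.Beats e) : prune T = prune U := by
  ext e
  constructor
  · rintro ⟨he, hT⟩
    refine ⟨hTU he, fun e' he' hb => ?_⟩
    obtain ⟨e'', he'', rfl | hb'⟩ := h e' he'
    · exact hT _ he'' hb
    · exact hT _ he'' (hb'.trans hb)
  · rintro ⟨he, hU⟩
    obtain ⟨e'', he'', rfl | hb'⟩ := h e he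
    · exact ⟨he'', fun e' he' => hU e' (hTU he')⟩
    · exact absurd hb' (hU _ (hTU he''))

lemma IsFirst.of_prune {S : Set Entry} (hS : S.Finite) {m : Entry} (h : IsFirst (prune S) m) :
    IsFirst S m := by
  refine ⟨h.1.1, fun e he => ?_⟩
  obtain ⟨e', he', rfl | hb⟩ := exists_mem_prune hS he
  · exact h.2 _ he'
  · exact (h.2 _ he').trans hb.precedes

/-! ### One step of the distributed computation -/

/-- What a node has computed so far: the least identity it has heard of, its pruned distance table,
and its copy of the table of its closest net point. -/
@[ext]
structure Info where
  leader : ℕ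
  entries : Set Entry
  copy : Set Entry

/-- What a node announces in every step: its information, and the last time at which it knows that
the information of some node has changed. -/
structure Announcement where
  info : Info
  clock : ℕ

/-- The initial information of a node that belongs to the first `r` sets of the hierarchy. -/
def initInfo (id r : ℕ) : Info := ⟨id, {e | 0 < r ∧ e = ⟨r, id, 0, 0⟩}, ∅⟩

/-- The new table of a node: its old table and the tables of its neighbours, shifted by the weights
of the edges to them. -/
def nextEntries (i : LocalInput) (E : Set Entry) (R : ℕ → Option Info) : Set Entry :=
  prune (E ∪ {e | ∃ j q c, R j = some q ∧ i.nbr j = some c ∧ ∃ e₀ ∈ q.entries, e = e₀.shift c})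

/-- `q` comes from a neighbour through which the first entry of the table `E` is reached. -/
def IsParentInfo (i : LocalInput) (E : Set Entry) (R : ℕ → Option Info) (q : Info) : Prop :=
  ∃ j c m, R j = some q ∧ i.nbr j = some c ∧ IsFirst q.entries m ∧ IsFirst E (m.shift c)

open Classical in
/-- The new copy of a node with table `E`: its own table if it is its own closest net point, and the
copy of a parent otherwise. -/
noncomputable def nextCopy (i : LocalInput) (E : Set Entry) (R : ℕ → Option Info) : Set Entry :=
  if ∃ m, IsFirst E m ∧ m.hop = 0 then E
  else if h : ∃ q, IsParentInfo i E R q then h.choose.copy else ∅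

/-- The new information of a node with input `i` and information `s`, when `R j` is the information
heard from the neighbour with identity `j`. -/
noncomputable def nextInfo (i : LocalInput) (s : Info) (R : ℕ → Option Info) : Info where
  leader := sInf (insert s.leader {x | ∃ j q, R j = some q ∧ x = q.leader})
  entries := nextEntries i s.entries R
  copy := nextCopy i (nextEntries i s.entries R) R

open Classical in
/-- The announcement of a node at time `t + 1`, given its announcement at time `t` and the
announcements heard. -/
noncomputable def nextAnnouncement (i : LocalInput) (t : ℕ) (a : Announcement)
    (R : ℕ → Option Announcement) : Announcement where
  info := nextInfo i a.info fun j => (R j).map Announcement.info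
  clock :=
    if nextInfo i a.info (fun j => (R j).map Announcement.info) = a.info then
      sSup (insert a.clock {x | ∃ j b, R j = some b ∧ x = b.clock})
    else t + 1

namespace Network

variable {V : Type*} (G : Network V) (r : V → ℕ)

/-- The announcements of all nodes at time `t`, as long as no node halts; `r v` is the number of
sets of the hierarchy that contain `v`. -/
noncomputable def run : ℕ → V → Announcement
  | 0 => fun v => ⟨initInfo (G.ident v) (r v), 0⟩
  | t + 1 => fun v =>
      nextAnnouncement (G.input v) t (run t v) (G.byIdent v fun w => some (run t w))

/-- The information of all nodes at time `t`, as long as no node halts. -/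
noncomputable def info (t : ℕ) (v : V) : Info := (G.run r t v).info

lemma map_byIdent {α β : Type*} (f : α → β) (g : V → Option α) (v : V) :
    (fun j => (G.byIdent v g j).map f) = G.byIdent v fun w => (g w).map f := by
  funext j
  by_cases hj : ∃ w, G.graph.Adj v w ∧ G.ident w = j
  · obtain ⟨w, hw, rfl⟩ := hj
    rw [G.byIdent_apply hw, G.byIdent_apply hw]
  · rw [G.byIdent_of_not_exists hj, G.byIdent_of_not_exists hj, Option.map_none]

lemma info_zero (v : V) : G.info r 0 v = initInfo (G.ident v) (r v) := rfl

lemma info_succ (t : ℕ) (v : V) :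
    G.info r (t + 1) v =
      nextInfo (G.input v) (G.info r t v) (G.byIdent v fun w => some (G.info r t w)) := by
  change nextInfo _ _ (fun j => (G.byIdent v (fun w => some (G.run r t w)) j).map _) = _
  rw [map_byIdent]
  rfl

open Classical in
lemma clock_succ (t : ℕ) (v : V) :
    (G.run r (t + 1) v).clock = if G.info r (t + 1) v = G.info r t v then
      sSup {x | ∃ w, (w = v ∨ G.graph.Adj v w) ∧ x = (G.run r t w).clock} else t + 1 := by
  change (if G.info r (t + 1) v = G.info r t v then
    sSup (insert (G.run r t v).clock {x | ∃ j b, G.byIdent v (fun w => some (G.run r t w)) j =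
      some b ∧ x = b.clock}) else t + 1) = _
  congr 2
  ext x
  simp only [Set.mem_insert_iff, Set.mem_ofPred_eq]
  constructor
  · rintro (rfl | ⟨j, b, hb, rfl⟩)
    · exact ⟨v, Or.inl rfl, rfl⟩
    · obtain ⟨w, hw, -, h⟩ := G.byIdent_eq_some_iff.1 hb
      exact ⟨w, Or.inr hw, by rw [Option.some.inj h]⟩
  · rintro ⟨w, rfl | hw, rfl⟩
    · exact Or.inl rfl
    · exact Or.inr ⟨_, _, G.byIdent_apply hw _, rfl⟩

lemma input_nbr {v w : V} (h : G.graph.Adj v w) :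
    (G.input v).nbr (G.ident w) = some (G.weight s(v, w)) :=
  G.byIdent_apply h fun w => some (G.weight s(v, w))

/-! ### Leaders and clocks -/

lemma leader_succ_le {t : ℕ} {v w : V} (h : G.graph.Adj v w) :
    (G.info r (t + 1) v).leader ≤ (G.info r t w).leader := by
  rw [info_succ]
  exact Nat.sInf_le (Or.inr ⟨_, _, G.byIdent_apply h _, rfl⟩)

lemma leader_succ_le_self {t : ℕ} {v : V} :
    (G.info r (t + 1) v).leader ≤ (G.info r t v).leader := by
  rw [info_succ]
  exact Nat.sInf_le (Or.inl rfl)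

lemma leader_add_le {v w : V} (p : G.graph.Walk v w) (t s : ℕ) (h : p.length ≤ s) :
    (G.info r (t + s) v).leader ≤ (G.info r t w).leader := by
  induction p generalizing s with
  | nil =>
    induction s with
    | zero => rfl
    | succ s ih => exact (G.leader_succ_le_self r).trans (ih (by simp))
  | cons ha p ih =>
    rw [SimpleGraph.Walk.length_cons] at h
    obtain ⟨s, rfl⟩ : ∃ s', s = s' + 1 := ⟨s - 1, by omega⟩
    exact (G.leader_succ_le r ha).trans (ih s (by omega))

lemma exists_leader_eq (t : ℕ) (v : V) :
    ∃ w, ∃ p : G.graph.Walk v w, p.length ≤ t ∧ (G.info r t v).leader = G.ident w := by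
  induction t generalizing v with
  | zero => exact ⟨v, .nil, le_rfl, rfl⟩
  | succ t ih =>
    have hmem : (G.info r (t + 1) v).leader ∈ insert (G.info r t v).leader
        {x | ∃ j q, G.byIdent v (fun w => some (G.info r t w)) j = some q ∧ x = q.leader} := by
      rw [info_succ]
      exact Nat.sInf_mem ⟨_, Or.inl rfl⟩
    rcases hmem with h | ⟨j, q, hq, h⟩
    · obtain ⟨w, p, hp, hw⟩ := ih v
      exact ⟨w, p, by omega, h.trans hw⟩
    · obtain ⟨u, hu, -, hqu⟩ := G.byIdent_eq_some_iff.1 hq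
      obtain ⟨w, p, hp, hw⟩ := ih u
      refine ⟨w, .cons hu p, by rw [SimpleGraph.Walk.length_cons]; omega, ?_⟩
      rw [h, ← Option.some.inj hqu, hw]

lemma clock_le [Finite V] (t : ℕ) (v : V) : (G.run r t v).clock ≤ t := by
  classical
  induction t generalizing v with
  | zero => exact le_rfl
  | succ t ih =>
    rw [clock_succ]
    split_ifs
    · refine csSup_le ⟨_, v, Or.inl rfl, rfl⟩ ?_
      rintro x ⟨w, -, rfl⟩
      exact (ih w).trans (Nat.le_succ t)
    · exact le_rfl

lemma clock_succ_ge [Finite V] {t : ℕ} {v w : V} (h : w = v ∨ G.graph.Adj v w) :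
    (G.run r t w).clock ≤ (G.run r (t + 1) v).clock := by
  classical
  rw [clock_succ]
  split_ifs
  · refine le_csSup ⟨t, ?_⟩ ⟨w, h, rfl⟩
    rintro x ⟨w, -, rfl⟩
    exact G.clock_le r t w
  · exact (G.clock_le r t w).trans (Nat.le_succ t)

/-- News of a change travels one edge per step. -/
lemma lt_clock_of_info_ne [Finite V] {v u : V} (p : G.graph.Walk v u) {s d : ℕ}
    (hp : p.length ≤ d) (h : G.info r (s + 1) u ≠ G.info r s u) :
    s < (G.run r (s + 1 + d) v).clock := by
  classical
  induction p generalizing d with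
  | nil =>
    induction d with
    | zero => rw [Nat.add_zero, clock_succ, if_neg h]; exact Nat.lt_succ_self s
    | succ d ih => exact (ih (by simp)).trans_le (G.clock_succ_ge r (Or.inl rfl))
  | cons ha p ih =>
    rw [SimpleGraph.Walk.length_cons] at hp
    obtain ⟨d, rfl⟩ : ∃ d', d = d' + 1 := ⟨d - 1, by omega⟩
    exact (ih (by omega) h).trans_le (G.clock_succ_ge r (Or.inr ha))

lemma info_eq_of_fixed {s : ℕ} (h : ∀ u, G.info r (s + 1) u = G.info r s u) {t : ℕ} (hst : s ≤ t)
    (u : V) : G.info r t u = G.info r s u := by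
  induction t, hst using Nat.le_induction generalizing u with
  | base => rfl
  | succ t _ ih =>
    rw [info_succ, ← h u, info_succ]
    simp only [ih]

lemma clock_le_of_fixed [Finite V] {T : ℕ}
    (h : ∀ t, T ≤ t → ∀ u, G.info r (t + 1) u = G.info r t u) (t : ℕ) (v : V) :
    (G.run r t v).clock ≤ T := by
  classical
  induction t generalizing v with
  | zero => exact Nat.zero_le _
  | succ t ih =>
    rw [clock_succ]
    split_ifs with h'
    · refine csSup_le ⟨_, v, Or.inl rfl, rfl⟩ ?_
      rintro x ⟨w, -, rfl⟩
      exact ih w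
    · by_contra hcon
      exact h' (h t (by omega) v)

/-- A node that still is its own leader and has heard of no change in the second half of the time
knows that the computation has come to rest: the wave of its identity, travelling outwards, would
otherwise have caused a change of which it has heard by now. -/
lemma info_fixed_of_clock [Finite V] {t : ℕ} {v : V} (hl : (G.info r t v).leader = G.ident v)
    (hc : 2 * (G.run r t v).clock + 2 ≤ t) (u : V) :
    G.info r ((G.run r t v).clock + 1) u = G.info r (G.run r t v).clock u := by
  set c := (G.run r t v).clock with hcdef
  have hnews : ∀ (u : V) (p : G.graph.Walk v u) (s : ℕ), s + 1 + p.length ≤ t → c ≤ s →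
      G.info r (s + 1) u = G.info r s u := by
    intro u p s hs hcs
    by_contra h
    have := G.lt_clock_of_info_ne r p (d := t - (s + 1)) (by omega) h
    rw [show s + 1 + (t - (s + 1)) = t by omega] at this
    omega
  have hball : ∀ u, ∃ p : G.graph.Walk v u, p.length ≤ c := by
    intro u
    obtain ⟨p⟩ := G.connected.preconnected u v
    induction p with
    | nil => exact ⟨.nil, by simp⟩
    | @cons u u' v ha p ih =>
      obtain ⟨q, hq⟩ := ih hl hc hcdef hnews
      by_contra hfar
      push Not at hfar
      have hcu := hnews u (q.concat ha.symm) c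
        (by rw [SimpleGraph.Walk.length_concat]; omega) le_rfl
      have h1 : (G.info r (c + 1) u).leader = G.ident v := by
        apply le_antisymm
        · have := G.leader_add_le r (q.concat ha.symm).reverse 0 (c + 1)
            (by rw [SimpleGraph.Walk.length_reverse, SimpleGraph.Walk.length_concat]; omega)
          rwa [Nat.zero_add] at this
        · rw [← hl]
          have := G.leader_add_le r (q.concat ha.symm) (c + 1) (t - (c + 1))
            (by rw [SimpleGraph.Walk.length_concat]; omega)
          rwa [show c + 1 + (t - (c + 1)) = t by omega] at this
      obtain ⟨w, p', hp', hw⟩ := G.exists_leader_eq r c u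
      rw [← hcu, h1] at hw
      obtain rfl := G.ident_injective hw
      have := hfar p'.reverse
      rw [SimpleGraph.Walk.length_reverse] at this
      omega
  obtain ⟨p, hp⟩ := hball u
  exact hnews u p c (by omega) le_rfl

end Network

namespace Network

variable {V : Type*} (G : Network V) (r : V → ℕ)

lemma leader_eq_of_isMin {t : ℕ} {v : V} (hv : ∀ w, G.ident v ≤ G.ident w) :
    (G.info r t v).leader = G.ident v := by
  obtain ⟨w, -, -, hw⟩ := G.exists_leader_eq r t v
  apply le_antisymm
  · have := G.leader_add_le r (.nil : G.graph.Walk v v) 0 t (by simp)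
    rwa [Nat.zero_add] at this
  · rw [hw]
    exact hv w

/-! ### Distance tables are pruned tables of walks -/

/-- The entries of all walks from `v` with at most `t` edges to nodes of positive level. -/
def walkEntries (t : ℕ) (v : V) : Set Entry :=
  {e | ∃ w, ∃ p : G.graph.Walk v w, p.length ≤ t ∧ 0 < r w ∧
    e = ⟨r w, G.ident w, G.walkWeight p, p.length⟩}

lemma walkEntries_succ (t : ℕ) (v : V) :
    G.walkEntries r (t + 1) v = G.walkEntries r t v ∪
      {e | ∃ w, G.graph.Adj v w ∧ ∃ e₀ ∈ G.walkEntries r t w,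
        e = e₀.shift (G.weight s(v, w))} := by
  ext e
  constructor
  · rintro ⟨w, p, hp, hw, rfl⟩
    cases p with
    | nil => exact Or.inl ⟨v, .nil, Nat.zero_le _, hw, rfl⟩
    | @cons _ u _ ha p =>
      rw [SimpleGraph.Walk.length_cons] at hp
      refine Or.inr ⟨u, ha, _, ⟨w, p, by omega, hw, rfl⟩, ?_⟩
      simp [Entry.shift]
  · rintro (⟨w, p, hp, hw, rfl⟩ | ⟨u, ha, _, ⟨w, p, hp, hw, rfl⟩, rfl⟩)
    · exact ⟨w, p, by omega, hw, rfl⟩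
    · refine ⟨w, .cons ha p, by rw [SimpleGraph.Walk.length_cons]; omega, hw, ?_⟩
      simp [Entry.shift]

lemma walkEntries_zero (v : V) :
    G.walkEntries r 0 v = {e | 0 < r v ∧ e = ⟨r v, G.ident v, 0, 0⟩} := by
  ext e
  constructor
  · rintro ⟨w, p, hp, hw, rfl⟩
    obtain rfl := SimpleGraph.Walk.eq_of_length_eq_zero (Nat.le_zero.1 hp)
    cases p with
    | nil => exact ⟨hw, rfl⟩
    | cons _ _ => simp at hp
  · rintro ⟨hv, rfl⟩
    exact ⟨v, .nil, le_rfl, hv, rfl⟩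

lemma finite_walkEntries [Finite V] (t : ℕ) (v : V) : (G.walkEntries r t v).Finite := by
  induction t generalizing v with
  | zero =>
    rw [walkEntries_zero]
    exact (Set.finite_singleton _).subset fun e he => he.2
  | succ t ih =>
    rw [walkEntries_succ]
    refine (ih v).union (Set.Finite.subset (Set.finite_iUnion fun w =>
      (ih w).image fun e => e.shift (G.weight s(v, w))) ?_)
    rintro e ⟨w, -, e₀, he₀, rfl⟩
    exact Set.mem_iUnion.2 ⟨w, e₀, he₀, rfl⟩

lemma entries_succ (t : ℕ) (v : V) :
    (G.info r (t + 1) v).entries = prune ((G.info r t v).entries ∪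
      {e | ∃ w, G.graph.Adj v w ∧ ∃ e₀ ∈ (G.info r t w).entries,
        e = e₀.shift (G.weight s(v, w))}) := by
  rw [info_succ]
  unfold nextInfo nextEntries
  dsimp only
  congr 2
  ext e
  constructor
  · rintro ⟨j, q, c, hq, hc, e₀, he₀, rfl⟩
    obtain ⟨w, hw, rfl, h⟩ := G.byIdent_eq_some_iff.1 hq
    rw [G.input_nbr hw] at hc
    obtain rfl := Option.some.inj h
    obtain rfl := Option.some.inj hc
    exact ⟨w, hw, e₀, he₀, rfl⟩
  · rintro ⟨w, hw, e₀, he₀, rfl⟩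
    exact ⟨G.ident w, _, _, G.byIdent_apply hw _, G.input_nbr hw, e₀, he₀, rfl⟩

lemma entries_eq [Finite V] (t : ℕ) (v : V) :
    (G.info r t v).entries = prune (G.walkEntries r t v) := by
  induction t generalizing v with
  | zero =>
    rw [walkEntries_zero, info_zero]
    unfold initInfo
    ext e
    constructor
    · rintro ⟨hv, rfl⟩
      refine ⟨⟨hv, rfl⟩, ?_⟩
      rintro e' ⟨-, rfl⟩ hb
      exact hb.not_precedes (Entry.Precedes.refl _)
    · exact fun h => h.1
  | succ t ih =>
    rw [entries_succ, walkEntries_succ]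
    simp only [ih]
    apply prune_eq_of_dominates
    · rintro e (he | ⟨w, hw, e₀, he₀, rfl⟩)
      · exact Or.inl (prune_subset _ he)
      · exact Or.inr ⟨w, hw, e₀, prune_subset _ he₀, rfl⟩
    · rintro e (he | ⟨w, hw, e₀, he₀, rfl⟩)
      · obtain ⟨e', he', h⟩ := exists_mem_prune (G.finite_walkEntries r t v) he
        exact ⟨e', Or.inl he', h⟩
      · obtain ⟨e', he', h⟩ := exists_mem_prune (G.finite_walkEntries r t w) he₀
        refine ⟨_, Or.inr ⟨w, hw, e', he', rfl⟩, ?_⟩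
        rcases h with rfl | h
        · exact Or.inl rfl
        · exact Or.inr (h.shift _)

lemma finite_entries [Finite V] (t : ℕ) (v : V) : (G.info r t v).entries.Finite := by
  rw [entries_eq]
  exact (G.finite_walkEntries r t v).subset (prune_subset _)

/-- Every entry of a table belongs to a path. -/
lemma exists_isPath_of_mem_entries [Finite V] {t : ℕ} {v : V} {e : Entry}
    (he : e ∈ (G.info r t v).entries) :
    ∃ w, ∃ p : G.graph.Walk v w, p.IsPath ∧ p.length ≤ t ∧ 0 < r w ∧
      e = ⟨r w, G.ident w, G.walkWeight p, p.length⟩ := by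
  rw [entries_eq] at he
  obtain ⟨⟨w, p, hp, hw, rfl⟩, hmin⟩ := he
  obtain ⟨q, hq, hle, hlen⟩ := G.exists_isPath_le p
  have := hmin _ ⟨w, q, hlen.trans hp, hw, rfl⟩
  rw [Entry.beats_mk] at this
  refine ⟨w, q, hq, hlen.trans hp, hw, ?_⟩
  ext <;> simp only
  all_goals omega

/-- Two entries of a table that belong to the same source are equal. -/
lemma entries_eq_of_id [Finite V] {t : ℕ} {v : V} {e e' : Entry}
    (he : e ∈ (G.info r t v).entries) (he' : e' ∈ (G.info r t v).entries) (h : e.id = e'.id) :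
    e = e' := by
  rw [entries_eq] at he he'
  have h1 := he.2 _ he'.1
  have h2 := he'.2 _ he.1
  obtain ⟨⟨w, p, hp, hw, rfl⟩, -⟩ := he
  obtain ⟨⟨w', p', hp', hw', rfl⟩, -⟩ := he'
  obtain rfl := G.ident_injective h
  rw [Entry.beats_mk] at h1 h2
  ext <;> simp only
  all_goals omega

/-! ### Copies of the tables of net points -/

lemma copy_succ_eq {t : ℕ} {v : V} :
    (G.info r (t + 1) v).copy = nextCopy (G.input v) (G.info r (t + 1) v).entries
      (G.byIdent v fun w => some (G.info r t w)) := by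
  rw [info_succ]
  rfl

lemma copy_of_no_entries {t : ℕ} {v : V} (h : (G.info r (t + 1) v).entries = ∅) :
    (G.info r (t + 1) v).copy = ∅ := by
  rw [copy_succ_eq, h]
  unfold nextCopy
  have h1 : ¬ ∃ m, IsFirst ∅ m ∧ m.hop = 0 := by
    rintro ⟨m, hm, -⟩
    exact hm.1
  have h2 : ¬ ∃ q, IsParentInfo (G.input v) ∅ (G.byIdent v fun w => some (G.info r t w)) q := by
    rintro ⟨q, j, c, m, -, -, -, hm⟩
    exact hm.1
  rw [if_neg h1, dif_neg h2]

lemma copy_of_hop_eq_zero {t : ℕ} {v : V} {m : Entry}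
    (hm : IsFirst (G.info r (t + 1) v).entries m) (h0 : m.hop = 0) :
    (G.info r (t + 1) v).copy = (G.info r (t + 1) v).entries := by
  rw [copy_succ_eq, nextCopy, if_pos ⟨m, hm, h0⟩]

/-- The walk of the first entry of a table starts with an edge to a parent, that is to a neighbour
whose first entry is the rest of that walk. -/
lemma exists_copy_eq [Finite V] {t : ℕ} {v : V} {m : Entry}
    (hm : IsFirst (G.info r (t + 1) v).entries m) (h0 : m.hop ≠ 0) :
    ∃ w m₀, G.graph.Adj v w ∧ IsFirst (G.info r t w).entries m₀ ∧
      m = m₀.shift (G.weight s(v, w)) ∧ (G.info r (t + 1) v).copy = (G.info r t w).copy := by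
  have h1 : ¬ ∃ m, IsFirst (G.info r (t + 1) v).entries m ∧ m.hop = 0 := by
    rintro ⟨m', hm', h0'⟩
    exact h0 (hm.unique hm' ▸ h0')
  have h2 : ∃ q, IsParentInfo (G.input v) (G.info r (t + 1) v).entries
      (G.byIdent v fun w => some (G.info r t w)) q := by
    have hm' := hm
    rw [entries_eq] at hm'
    have hm' := hm'.of_prune (G.finite_walkEntries r _ _)
    obtain ⟨w, p, hp, hw, hmp⟩ := hm'.1
    cases p with
    | nil => rw [hmp] at h0; exact absurd rfl h0
    | @cons _ u _ ha p =>
      rw [SimpleGraph.Walk.length_cons] at hp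
      have he₀ : ⟨r w, G.ident w, G.walkWeight p, p.length⟩ ∈ G.walkEntries r t u :=
        ⟨w, p, by omega, hw, rfl⟩
      obtain ⟨e', he', -⟩ := exists_mem_prune (G.finite_walkEntries r t u) he₀
      rw [← entries_eq] at he'
      obtain ⟨m₀, hm₀⟩ := exists_isFirst (G.finite_entries r t u) ⟨e', he'⟩
      refine ⟨_, G.ident u, _, m₀, G.byIdent_apply ha _, G.input_nbr ha, hm₀, ?_⟩
      have hm₀' := hm₀
      rw [entries_eq] at hm₀'
      have hm₀' := hm₀'.of_prune (G.finite_walkEntries r _ _)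
      have key : m = m₀.shift (G.weight s(v, u)) := by
        apply (hm'.2 _ _).antisymm
        · have := (hm₀'.2 _ he₀).shift (G.weight s(v, u))
          rw [hmp]
          simpa [Entry.shift] using this
        · rw [walkEntries_succ]
          exact Or.inr ⟨u, ha, m₀, hm₀'.1, rfl⟩
      rw [← key]
      exact hm
  rw [copy_succ_eq, nextCopy, if_neg h1, dif_pos h2]
  obtain ⟨j, c, m₀, hq, hc, hm₀, hmc⟩ := h2.choose_spec
  obtain ⟨w, hw, rfl, hwq⟩ := G.byIdent_eq_some_iff.1 hq
  rw [G.input_nbr hw] at hc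
  obtain rfl := Option.some.inj hc
  rw [← Option.some.inj hwq] at hm₀ ⊢
  exact ⟨w, m₀, hw, hm₀, hm.unique hmc, rfl⟩

/-- A copy is empty or equal to a table. -/
lemma copy_eq_empty_or [Finite V] (t : ℕ) (v : V) :
    (G.info r t v).copy = ∅ ∨ ∃ s w, s ≤ t ∧ (G.info r t v).copy = (G.info r s w).entries := by
  induction t generalizing v with
  | zero => exact Or.inl rfl
  | succ t ih =>
    rcases (G.info r (t + 1) v).entries.eq_empty_or_nonempty with h | h
    · exact Or.inl (G.copy_of_no_entries r h)
    · obtain ⟨m, hm⟩ := exists_isFirst (G.finite_entries r (t + 1) v) h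
      by_cases h0 : m.hop = 0
      · exact Or.inr ⟨t + 1, v, le_rfl, G.copy_of_hop_eq_zero r hm h0⟩
      · obtain ⟨w, m₀, -, -, -, hc⟩ := G.exists_copy_eq r hm h0
        rw [hc]
        rcases ih w with h | ⟨s, z, hs, h⟩
        · exact Or.inl h
        · exact Or.inr ⟨s, z, by omega, h⟩

/-! ### The limit of the computation -/

/-- The table at the end of the computation: the true distances to the sources `w` that are closer
than all sources of higher level. -/
def finalEntries (v : V) : Set Entry :=
  {e | ∃ w, 0 < r w ∧ (∀ z, r w < r z → G.dist v w < G.dist v z) ∧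
    e = ⟨r w, G.ident w, G.dist v w, G.hops v w⟩}

section Fintype

variable [Fintype V]

lemma mem_walkEntries_dist {t : ℕ} (ht : G.spDiam ≤ t) (v w : V) (hw : 0 < r w) :
    ⟨r w, G.ident w, G.dist v w, G.hops v w⟩ ∈ G.walkEntries r t v := by
  obtain ⟨p, -, hpd, hpl⟩ := G.exists_isPath_dist_hops v w
  exact ⟨w, p, by rw [hpl]; exact (G.hops_le_spDiam v w).trans ht, hw, by rw [hpd, hpl]⟩

lemma prune_walkEntries {t : ℕ} (ht : G.spDiam ≤ t) (v : V) :
    prune (G.walkEntries r t v) = G.finalEntries r v := by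
  ext e
  constructor
  · rintro ⟨⟨w, p, hp, hw, rfl⟩, hmin⟩
    refine ⟨w, hw, fun z hz => ?_, ?_⟩
    · have := hmin _ (G.mem_walkEntries_dist r ht v z (by omega))
      rw [Entry.beats_mk] at this
      have := G.dist_le_walkWeight p
      have h2 := hmin _ (G.mem_walkEntries_dist r ht v w hw)
      rw [Entry.beats_mk] at h2
      omega
    · have h1 := hmin _ (G.mem_walkEntries_dist r ht v w hw)
      rw [Entry.beats_mk] at h1
      have h2 := G.dist_le_walkWeight p
      have h3 : G.walkWeight p = G.dist v w := by omega
      have h4 := G.hops_le_length p h3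
      ext <;> simp only
      all_goals omega
  · rintro ⟨w, hw, hfar, rfl⟩
    refine ⟨G.mem_walkEntries_dist r ht v w hw, ?_⟩
    rintro e' ⟨z, p, hp, hz, rfl⟩ hb
    have h1 := G.dist_le_walkWeight p
    rw [Entry.beats_mk] at hb
    rcases hb with ⟨hlt, hle⟩ | ⟨-, hid, hb⟩
    · have := hfar z hlt
      omega
    · obtain rfl := G.ident_injective hid
      by_cases h3 : G.walkWeight p = G.dist v z
      · have h4 := G.hops_le_length p h3
        omega
      · omega

lemma entries_eq_finalEntries {t : ℕ} (ht : G.spDiam ≤ t) (v : V) :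
    (G.info r t v).entries = G.finalEntries r v := by
  rw [entries_eq, prune_walkEntries _ _ ht]

lemma finite_finalEntries (v : V) : (G.finalEntries r v).Finite := by
  rw [← G.entries_eq_finalEntries r le_rfl v]
  exact G.finite_entries r _ v

/-- Every source is matched in the final table by a source of at least the same level that is not
farther away. -/
lemma exists_mem_finalEntries {v w : V} (hw : 0 < r w) :
    ∃ z, 0 < r z ∧ ⟨r z, G.ident z, G.dist v z, G.hops v z⟩ ∈ G.finalEntries r v ∧
      r w ≤ r z ∧ G.dist v z ≤ G.dist v w := by
  obtain ⟨e, he, h⟩ := exists_mem_prune (G.finite_walkEntries r G.spDiam v)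
    (G.mem_walkEntries_dist r le_rfl v w hw)
  rw [G.prune_walkEntries r le_rfl] at he
  have he' := he
  obtain ⟨z, hz, -, rfl⟩ := he'
  refine ⟨z, hz, he, ?_⟩
  rcases h with h | h
  · simp only [Entry.mk.injEq] at h
    omega
  · rw [Entry.beats_mk] at h
    omega

/-- The table of the closest net point arrives along a shortest path, one edge per step. -/
lemma copy_eq_finalEntries {v w : V} {h : ℕ} {d : ℕ}
    (hm : IsFirst (G.finalEntries r v) ⟨r w, G.ident w, d, h⟩) {t : ℕ}
    (ht : G.spDiam + 1 + h ≤ t) : (G.info r t v).copy = G.finalEntries r w := by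
  induction h generalizing v d t with
  | zero =>
    obtain ⟨t, rfl⟩ : ∃ t', t = t' + 1 := ⟨t - 1, by omega⟩
    rw [← G.entries_eq_finalEntries r (t := t + 1) (by omega)] at hm
    rw [G.copy_of_hop_eq_zero r hm rfl]
    obtain ⟨w', p, -, -, -, hp⟩ := G.exists_isPath_of_mem_entries r hm.1
    simp only [Entry.mk.injEq] at hp
    obtain rfl := G.ident_injective hp.2.1
    obtain rfl := SimpleGraph.Walk.eq_of_length_eq_zero hp.2.2.2.symm
    rw [G.entries_eq_finalEntries r (by omega)]
  | succ h ih =>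
    obtain ⟨t, rfl⟩ : ∃ t', t = t' + 1 := ⟨t - 1, by omega⟩
    rw [← G.entries_eq_finalEntries r (t := t + 1) (by omega)] at hm
    obtain ⟨u, m₀, hu, hm₀, hmm, hc⟩ := G.exists_copy_eq r hm (by simp)
    rw [hc]
    rw [G.entries_eq_finalEntries r (by omega)] at hm₀
    obtain ⟨l, x, y, g⟩ := m₀
    simp only [Entry.shift, Entry.mk.injEq] at hmm
    obtain ⟨rfl, rfl, -, hg⟩ := hmm
    obtain rfl : h = g := by omega
    exact ih hm₀ (by omega)

/-- The information of a node does not change any more after `2 * S + 1` steps. -/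
lemma info_stable {t : ℕ} (ht : 2 * G.spDiam + 1 ≤ t) (v : V) :
    G.info r (t + 1) v = G.info r t v := by
  have hE : (G.info r (t + 1) v).entries = (G.info r t v).entries := by
    rw [G.entries_eq_finalEntries r (by omega), G.entries_eq_finalEntries r (by omega)]
  ext1
  · apply le_antisymm (G.leader_succ_le_self r)
    obtain ⟨w, -, -, hw⟩ := G.exists_leader_eq r (t + 1) v
    rw [hw]
    obtain ⟨p, hp⟩ := G.exists_walk_length_le_spDiam v w
    have := G.leader_add_le r p 0 t (by omega)
    rwa [Nat.zero_add] at this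
  · exact hE
  · rcases (G.finalEntries r v).eq_empty_or_nonempty with h | h
    · obtain ⟨t, rfl⟩ : ∃ t', t = t' + 1 := ⟨t - 1, by omega⟩
      rw [copy_of_no_entries, copy_of_no_entries] <;>
        rw [G.entries_eq_finalEntries r (by omega), h]
    · obtain ⟨m, hm⟩ := exists_isFirst (G.finite_finalEntries r v) h
      obtain ⟨w, hw, -, rfl⟩ := hm.1
      have := G.hops_le_spDiam v w
      rw [G.copy_eq_finalEntries r hm (by omega), G.copy_eq_finalEntries r hm (by omega)]

end Fintype

end Network

/-! ### Encoding announcements -/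

/-- `S` consists of at most `W` entries with numbers below `Q`. -/
def SmallTable (Q W : ℕ) (S : Set Entry) : Prop :=
  S.Finite ∧ S.ncard ≤ W ∧ ∀ e ∈ S, e.lev < Q ∧ e.id < Q ∧ e.dist < Q ∧ e.hop < Q

/-- The announcement fits into `2 * W + 2` letters of an alphabet with `Q ^ 5` letters. -/
def Announcement.Small (Q W : ℕ) (a : Announcement) : Prop :=
  a.info.leader < Q ∧ a.clock < Q ∧ SmallTable Q W a.info.entries ∧ SmallTable Q W a.info.copy

/-- The letters of an announcement: its numbers and entries, tagged by the part of the announcement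
to which they belong. -/
def Announcement.items (a : Announcement) : Set (ℕ × Entry) :=
  {(0, ⟨a.info.leader, 0, 0, 0⟩), (1, ⟨a.clock, 0, 0, 0⟩)} ∪
    ((fun e => (2, e)) '' a.info.entries ∪ (fun e => (3, e)) '' a.info.copy)

/-- Recovers an announcement from its letters. -/
noncomputable def ofItems (I : Set (ℕ × Entry)) : Announcement where
  info :=
    { leader := sInf {x | (0, ⟨x, 0, 0, 0⟩) ∈ I}
      entries := {e | (2, e) ∈ I}
      copy := {e | (3, e) ∈ I} }
  clock := sInf {x | (1, ⟨x, 0, 0, 0⟩) ∈ I}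

lemma ofItems_items (a : Announcement) : ofItems a.items = a := by
  obtain ⟨⟨l, E, F⟩, c⟩ := a
  simp [ofItems, Announcement.items]

lemma Announcement.Small.items_finite {Q W : ℕ} {a : Announcement} (h : a.Small Q W) :
    a.items.Finite :=
  (Set.toFinite _).union ((h.2.2.1.1.image _).union (h.2.2.2.1.image _))

lemma Announcement.Small.ncard_items_le {Q W : ℕ} {a : Announcement} (h : a.Small Q W) :
    a.items.ncard ≤ 2 * W + 2 := by
  unfold Announcement.items
  have h1 := Set.ncard_union_le {(0, (⟨a.info.leader, 0, 0, 0⟩ : Entry)), (1, ⟨a.clock, 0, 0, 0⟩)}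
    ((fun e => (2, e)) '' a.info.entries ∪ (fun e => (3, e)) '' a.info.copy)
  have h2 := Set.ncard_union_le ((fun e : Entry => (2, e)) '' a.info.entries)
    ((fun e => (3, e)) '' a.info.copy)
  have h3 := Set.ncard_image_le (f := fun e : Entry => (2, e)) h.2.2.1.1
  have h4 := Set.ncard_image_le (f := fun e : Entry => (3, e)) h.2.2.2.1
  have h5 := Set.ncard_insert_le (0, (⟨a.info.leader, 0, 0, 0⟩ : Entry)) {(1, ⟨a.clock, 0, 0, 0⟩)}
  rw [Set.ncard_singleton] at h5
  have h6 := h.2.2.1.2.1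
  have h7 := h.2.2.2.2.1
  omega

/-- The item with the five digits of a letter. -/
def itemOfDigits {Q : ℕ} (d : Fin 5 → Fin Q) : ℕ × Entry := (d 0, ⟨d 1, d 2, d 3, d 4⟩)

lemma Announcement.Small.exists_digits {Q W : ℕ} (hQ : 4 ≤ Q) {a : Announcement}
    (h : a.Small Q W) {x : ℕ × Entry} (hx : x ∈ a.items) :
    ∃ d : Fin 5 → Fin Q, itemOfDigits d = x := by
  obtain ⟨h1, h2, h3, h4⟩ := h
  have key : x.1 < Q ∧ x.2.lev < Q ∧ x.2.id < Q ∧ x.2.dist < Q ∧ x.2.hop < Q := by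
    rcases hx with (rfl | rfl) | ⟨e, he, rfl⟩ | ⟨e, he, rfl⟩
    · simp only; omega
    · simp only; omega
    · exact ⟨show 2 < Q by omega, h3.2.2 e he⟩
    · exact ⟨show 3 < Q by omega, h4.2.2 e he⟩
  obtain ⟨k0, k1, k2, k3, k4⟩ := key
  exact ⟨![⟨_, k0⟩, ⟨_, k1⟩, ⟨_, k2⟩, ⟨_, k3⟩, ⟨_, k4⟩], rfl⟩

/-- Small announcements can be sent as words of length `2 * W + 2`. -/
lemma exists_code {Q W M : ℕ} (hQ : 4 ≤ Q) (hM : M = Q ^ 5) :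
    ∃ (code : Announcement → Fin (2 * W + 2) → Fin M)
      (decode : (Fin (2 * W + 2) → Fin M) → Announcement),
      ∀ a : Announcement, a.Small Q W → decode (code a) = a := by
  classical
  subst hM
  let decode : (Fin (2 * W + 2) → Fin (Q ^ 5)) → Announcement := fun x =>
    ofItems (Set.range fun s => itemOfDigits (finFunctionFinEquiv.symm (x s)))
  have key : ∀ a : Announcement, a.Small Q W → ∃ x, decode x = a := by
    intro a ha
    have : Fintype a.items := ha.items_finite.fintype
    have hcard : Fintype.card a.items ≤ Fintype.card (Fin (2 * W + 2)) := by
      rw [Fintype.card_fin, ← Nat.card_eq_fintype_card]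
      exact ha.ncard_items_le
    obtain ⟨g⟩ := Function.Embedding.nonempty_of_card_le hcard
    have : Nonempty a.items := ⟨⟨_, Or.inl (Or.inl rfl)⟩⟩
    have hsurj := Function.invFun_surjective g.injective
    choose d hd using fun x : a.items => ha.exists_digits hQ x.2
    refine ⟨fun s => finFunctionFinEquiv (d (Function.invFun g s)), ?_⟩
    have hr : (Set.range fun s => itemOfDigits (finFunctionFinEquiv.symm
        (finFunctionFinEquiv (d (Function.invFun g s))))) = a.items := by
      ext x
      simp only [Equiv.symm_apply_apply, hd, Set.mem_range]
      constructor
      · rintro ⟨s, rfl⟩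
        exact (Function.invFun g s).2
      · intro hx
        obtain ⟨s, hs⟩ := hsurj ⟨x, hx⟩
        exact ⟨s, by rw [hs]⟩
    change ofItems _ = a
    rw [hr, ofItems_items]
  have : Inhabited (Fin (2 * W + 2) → Fin (Q ^ 5)) := ⟨fun _ => ⟨0, by positivity⟩⟩
  refine ⟨fun a => if h : ∃ x, decode x = a then h.choose else default, decode, fun a ha => ?_⟩
  have h := key a ha
  dsimp only
  rw [dif_pos h]
  exact h.choose_spec

/-! ### Sketches from tables -/

open Classical in
/-- The Thorup-Zwick label read off from a table. -/
noncomputable def labelOf (k : ℕ) (S : Set Entry) : TZLabel k where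
  pivot i := if h : ∃ m, IsFirst {e | e ∈ S ∧ (i : ℕ) < e.lev} m then
    some (h.choose.id, h.choose.dist) else none
  bunch i := if h : {e | e ∈ S ∧ e.lev = i + 1}.Finite then
    h.toFinset.toList.map fun e => (e.id, e.dist) else []

open Classical in
/-- The sketch read off from the information of a node. -/
noncomputable def sketchOf (k : ℕ) (s : Info) : CDGSketch k where
  netPoint := if h : ∃ m, IsFirst s.entries m then h.choose.id else 0
  netDist := if h : ∃ m, IsFirst s.entries m then h.choose.dist else 0
  label := labelOf k s.copy

lemma netPoint_sketchOf {k : ℕ} {s : Info} {m : Entry} (hm : IsFirst s.entries m) :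
    (sketchOf k s).netPoint = m.id ∧ (sketchOf k s).netDist = m.dist := by
  have h : ∃ m, IsFirst s.entries m := ⟨m, hm⟩
  unfold sketchOf
  dsimp only
  rw [dif_pos h, dif_pos h, h.choose_spec.unique hm]
  exact ⟨rfl, rfl⟩

lemma length_bunch_labelOf {k : ℕ} (S : Set Entry) (i : Fin k) :
    ((labelOf k S).bunch i).length ≤ {e | e ∈ S ∧ e.lev = i + 1}.ncard := by
  unfold labelOf
  dsimp only
  split_ifs with h
  · rw [List.length_map, Finset.length_toList, Set.ncard_eq_toFinset_card _ h]
  · exact Nat.zero_le _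

namespace Network

variable {V : Type*} [Fintype V] (G : Network V) (r : V → ℕ)

lemma isTZLabel_labelOf {k : ℕ} {A : ℕ → Set V} (hA : ∀ i, A i = {v | i < r v}) (v : V) :
    G.IsTZLabel A v (labelOf k (G.finalEntries r v)) := by
  intro i
  have hfin := G.finite_finalEntries r v
  refine ⟨?_, ?_, ?_⟩
  · unfold labelOf
    dsimp only
    split_ifs with h
    · right
      have hm := h.choose_spec
      obtain ⟨w, hw, hfar, he⟩ := hm.1.1
      have hlev := hm.1.2
      rw [he] at hm hlev
      rw [he]
      refine ⟨w, ⟨by rw [hA]; exact hlev, fun y hy => ?_⟩, rfl⟩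
      rw [hA] at hy
      obtain ⟨z, hz, hzm, hyz, hd⟩ := G.exists_mem_finalEntries r (v := v) (w := y)
        (Nat.zero_lt_of_lt hy)
      have := hm.2 _ ⟨hzm, lt_of_lt_of_le hy hyz⟩
      unfold Entry.Precedes at this
      simp only at this
      omega
    · left
      refine ⟨?_, rfl⟩
      rw [hA, Set.eq_empty_iff_forall_notMem]
      intro y hy
      obtain ⟨z, hz, hzm, hyz, hd⟩ := G.exists_mem_finalEntries r (v := v) (w := y)
        (Nat.zero_lt_of_lt hy)
      exact h (exists_isFirst (hfin.subset fun _ h => h.1) ⟨_, hzm, lt_of_lt_of_le hy hyz⟩)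
  · unfold labelOf
    dsimp only
    rw [dif_pos (hfin.subset fun _ h => h.1)]
    refine List.Nodup.map_on ?_ (Finset.nodup_toList _)
    intro e he e' he' heq
    rw [Finset.mem_toList, Set.Finite.mem_toFinset] at he he'
    rw [← G.entries_eq_finalEntries r le_rfl v] at he he'
    exact G.entries_eq_of_id r he.1 he'.1 (Prod.mk.inj heq).1
  · intro x
    unfold labelOf
    dsimp only
    rw [dif_pos (hfin.subset fun _ h => h.1), List.mem_map]
    simp only [Finset.mem_toList, Set.Finite.mem_toFinset]
    constructor
    · rintro ⟨e, ⟨⟨w, hw, hfar, rfl⟩, hlev⟩, rfl⟩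
      simp only at hlev
      refine ⟨w, ⟨?_, fun y hy => ?_⟩, rfl⟩
      · rw [hA, Set.mem_ofPred_eq]
        omega
      · rw [hA, Set.mem_ofPred_eq] at hy
        exact hfar y (by omega)
    · rintro ⟨w, ⟨hw, hfar⟩, rfl⟩
      simp only [hA, Set.mem_ofPred_eq] at hw hfar
      have hlev : r w = i + 1 := by
        by_contra h
        exact lt_irrefl _ (hfar w (by omega))
      exact ⟨_, ⟨⟨w, by omega, fun z hz => hfar z (by omega), rfl⟩, hlev⟩, rfl⟩

/-- Once the computation has come to rest, every node knows its sketch. -/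
lemma isCDGSketch_sketchOf {k : ℕ} {A : ℕ → Set V} (hA : ∀ i, A i = {v | i < r v})
    (h0 : (A 0).Nonempty) (v : V) :
    G.IsCDGSketch A v (sketchOf k (G.info r (2 * G.spDiam + 1) v)) := by
  obtain ⟨y, hy⟩ := h0
  rw [hA] at hy
  obtain ⟨z, hz, hzm, -⟩ := G.exists_mem_finalEntries r (v := v) (w := y) hy
  obtain ⟨m, hm⟩ := exists_isFirst (G.finite_finalEntries r v) ⟨_, hzm⟩
  obtain ⟨w, hw, -, rfl⟩ := hm.1
  have hS := G.hops_le_spDiam v w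
  have hE := G.entries_eq_finalEntries r (t := 2 * G.spDiam + 1) (by omega) v
  have hm' := hm
  rw [← hE] at hm'
  obtain ⟨h1, h2⟩ := netPoint_sketchOf (k := k) hm'
  refine ⟨w, ⟨by rw [hA]; exact hw, fun y hy => ?_⟩, h1, h2, ?_⟩
  · rw [hA] at hy
    obtain ⟨z, hz, hzm, -, hd⟩ := G.exists_mem_finalEntries r (v := v) (w := y) hy
    have := hm.2 _ hzm
    unfold Entry.Precedes at this
    simp only at this
    omega
  · simp only [sketchOf]
    rw [G.copy_eq_finalEntries r hm (by omega)]
    exact G.isTZLabel_labelOf r hA w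

end Network

/-! ### The sketching algorithm -/

/-- The state of a node: its input, the number of steps done, its announcement, and whether it has
noticed that a neighbour has halted. -/
structure NodeState where
  input : LocalInput
  time : ℕ
  ann : Announcement
  stopped : Prop

/-- A node may halt if a neighbour has halted, if its announcement is too large to be sent, or if it
is its own leader and has heard of no change in the second half of the time. -/
def NodeState.Done (Q W : ℕ) (σ : NodeState) : Prop :=
  σ.stopped ∨ ¬ σ.ann.Small Q W ∨
    (σ.ann.info.leader = σ.input.ident ∧ 2 * σ.ann.clock + 2 ≤ σ.time)

open Classical in
/-- The algorithm that computes the sketches; `level τ` is the number of sets of the hierarchy that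
a node with random source `τ` belongs to. -/
noncomputable def sketchAlg (Q W k : ℕ) (level : Tape → ℕ) :
    BroadcastAlg Announcement (CDGSketch k) where
  State := NodeState
  init i τ := ⟨i, 0, ⟨initInfo i.ident (level τ), 0⟩, False⟩
  announce σ := σ.ann
  step σ R :=
    if ∃ j, σ.input.nbr j ≠ none ∧ R j = none then ⟨σ.input, σ.time, σ.ann, True⟩
    else ⟨σ.input, σ.time + 1, nextAnnouncement σ.input σ.time σ.ann R, σ.stopped⟩
  output σ := if σ.Done Q W then some (sketchOf k σ.ann.info) else none

section

variable {V : Type*} {Q W k : ℕ} {level : Tape → ℕ} (G : Network V) (ω : V → Tape)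

/-- The state of node `v` after `t` steps. -/
noncomputable abbrev nodeState (Q W k : ℕ) (level : Tape → ℕ) (G : Network V) (ω : V → Tape)
    (t : ℕ) (v : V) : NodeState := (sketchAlg Q W k level).state G ω t v

open Classical in
lemma output_sketchAlg_eq_none (σ : NodeState) :
    (sketchAlg Q W k level).output σ = none ↔ ¬ σ.Done Q W := by
  change (if σ.Done Q W then _ else none) = none ↔ _
  split_ifs with h <;> simp [h]

lemma output_sketchAlg_eq_some {σ : NodeState} (h : σ.Done Q W) :
    (sketchAlg Q W k level).output σ = some (sketchOf k σ.ann.info) := if_pos h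

lemma nodeState_succ_of_done {t : ℕ} {v : V} (h : (nodeState Q W k level G ω t v).Done Q W) :
    nodeState Q W k level G ω (t + 1) v = nodeState Q W k level G ω t v := by
  classical
  unfold nodeState
  rw [BroadcastAlg.state_succ, if_neg]
  exact fun h0 => (output_sketchAlg_eq_none _).1 h0 h

open Classical in
lemma nodeState_succ_of_not_done {t : ℕ} {v : V}
    (h : ¬ (nodeState Q W k level G ω t v).Done Q W) {R : ℕ → Option Announcement}
    (hR : R = G.byIdent v fun w => if (nodeState Q W k level G ω t w).Done Q W then none
      else some (nodeState Q W k level G ω t w).ann) :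
    nodeState Q W k level G ω (t + 1) v =
      if ∃ j, (nodeState Q W k level G ω t v).input.nbr j ≠ none ∧ R j = none then
        ⟨(nodeState Q W k level G ω t v).input, (nodeState Q W k level G ω t v).time,
          (nodeState Q W k level G ω t v).ann, True⟩
      else ⟨(nodeState Q W k level G ω t v).input, (nodeState Q W k level G ω t v).time + 1,
        nextAnnouncement (nodeState Q W k level G ω t v).input
          (nodeState Q W k level G ω t v).time (nodeState Q W k level G ω t v).ann R,
          (nodeState Q W k level G ω t v).stopped⟩ := by
  have hR' : R = G.byIdent v fun w =>
      (sketchAlg Q W k level).heard ((sketchAlg Q W k level).state G ω t w) := by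
    rw [hR]
    apply G.byIdent_congr
    intro w _
    unfold BroadcastAlg.heard
    by_cases hw : (nodeState Q W k level G ω t w).Done Q W
    · rw [if_pos hw, if_neg]
      exact fun h0 => (output_sketchAlg_eq_none _).1 h0 hw
    · rw [if_neg hw, if_pos ((output_sketchAlg_eq_none _).2 hw)]
      rfl
  subst hR'
  conv_lhs => unfold nodeState
  rw [BroadcastAlg.state_succ, if_pos ((output_sketchAlg_eq_none _).2 h)]
  rfl

lemma nodeState_input (t : ℕ) (v : V) :
    (nodeState Q W k level G ω t v).input = G.input v := by
  classical
  induction t with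
  | zero => rfl
  | succ t ih =>
    by_cases h : (nodeState Q W k level G ω t v).Done Q W
    · rw [nodeState_succ_of_done G ω h, ih]
    · rw [nodeState_succ_of_not_done G ω h rfl]
      split_ifs <;> exact ih

lemma done_mono {t s : ℕ} (hts : t ≤ s) {v : V} (h : (nodeState Q W k level G ω t v).Done Q W) :
    (nodeState Q W k level G ω s v).Done Q W := by
  induction s, hts using Nat.le_induction with
  | base => exact h
  | succ s _ ih => rw [nodeState_succ_of_done G ω ih]; exact ih

/-- A node notices that a neighbour has halted. -/
lemma done_of_adj {t : ℕ} {v w : V} (ha : G.graph.Adj v w)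
    (h : (nodeState Q W k level G ω t w).Done Q W) :
    (nodeState Q W k level G ω (t + 1) v).Done Q W := by
  classical
  by_cases hv : (nodeState Q W k level G ω t v).Done Q W
  · exact done_mono G ω (Nat.le_succ t) hv
  · rw [nodeState_succ_of_not_done G ω hv rfl, if_pos]
    · exact Or.inl trivial
    · refine ⟨G.ident w, ?_, ?_⟩
      · rw [nodeState_input, G.input_nbr ha]; simp
      · rw [G.byIdent_apply ha, if_pos h]

lemma done_of_walk {v w : V} (p : G.graph.Walk v w) {t s : ℕ} (hp : p.length ≤ s)
    (h : (nodeState Q W k level G ω t w).Done Q W) :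
    (nodeState Q W k level G ω (t + s) v).Done Q W := by
  induction p generalizing s with
  | nil => exact done_mono G ω (Nat.le_add_right t s) h
  | cons ha p ih =>
    rw [SimpleGraph.Walk.length_cons] at hp
    obtain ⟨s, rfl⟩ : ∃ s', s = s' + 1 := ⟨s - 1, by omega⟩
    exact done_of_adj G ω ha (ih (by omega) h)

/-- As long as no node halts, the algorithm follows `Network.run`. -/
lemma nodeState_eq_run {t : ℕ}
    (h : ∀ s < t, ∀ v, ¬ (nodeState Q W k level G ω s v).Done Q W) (v : V) :
    nodeState Q W k level G ω t v =
      ⟨G.input v, t, G.run (fun v => level (ω v)) t v, False⟩ := by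
  classical
  induction t generalizing v with
  | zero => rfl
  | succ t ih =>
    have ih' := ih fun s hs => h s (by omega)
    have hR : (G.byIdent v fun w => some (G.run (fun v => level (ω v)) t w)) =
        G.byIdent v fun w => if (nodeState Q W k level G ω t w).Done Q W then none
          else some (nodeState Q W k level G ω t w).ann := by
      congr 1
      funext w
      rw [if_neg (h t (Nat.lt_succ_self t) w), ih']
    rw [nodeState_succ_of_not_done G ω (h t (Nat.lt_succ_self t) v) hR, ih' v, if_neg]
    · rfl
    · rintro ⟨j, hj, hj'⟩
      by_cases hex : ∃ w, G.graph.Adj v w ∧ G.ident w = j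
      · obtain ⟨w, hw, rfl⟩ := hex
        rw [G.byIdent_apply hw] at hj'
        cases hj'
      · exact hj (G.byIdent_of_not_exists hex fun w => some (G.weight s(v, w)))

variable [Fintype V]

/-- The clocks never exceed `2 * S + 1`, so the node of least identity halts by step `4 * S + 4` if
no other node does so before; after `S` further steps the silence has reached every node. -/
lemma all_done (v : V) : (nodeState Q W k level G ω (5 * G.spDiam + 4) v).Done Q W := by
  have hfirst : ∃ w, (nodeState Q W k level G ω (4 * G.spDiam + 4) w).Done Q W := by
    by_contra hcon
    push Not at hcon
    have hnone : ∀ s < 4 * G.spDiam + 4, ∀ w, ¬ (nodeState Q W k level G ω s w).Done Q W :=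
      fun s hs w h => hcon w (done_mono G ω hs.le h)
    have : Nonempty V := ⟨v⟩
    obtain ⟨w, hw⟩ := Finite.exists_min G.ident
    apply hcon w
    rw [nodeState_eq_run G ω hnone w]
    refine Or.inr (Or.inr ⟨G.leader_eq_of_isMin _ hw, ?_⟩)
    have := G.clock_le_of_fixed (fun v => level (ω v)) (T := 2 * G.spDiam + 1)
      (fun t ht u => G.info_stable _ ht u) (4 * G.spDiam + 4) w
    simp only
    omega
  obtain ⟨w, hw⟩ := hfirst
  obtain ⟨p, hp⟩ := G.exists_walk_length_le_spDiam v w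
  have := done_of_walk G ω p hp hw
  rwa [show 4 * G.spDiam + 4 + G.spDiam = 5 * G.spDiam + 4 by omega] at this

/-- If no announcement is too large, then the first node that halts knows that the computation has
come to rest, and halting does not disturb the information of the other nodes. -/
lemma nodeState_cases
    (hgood : ∀ t v, (G.run (fun v => level (ω v)) t v).Small Q W) (t : ℕ) :
    (∀ s < t, ∀ v, ¬ (nodeState Q W k level G ω s v).Done Q W) ∨
      ∀ v, (nodeState Q W k level G ω t v).ann.info =
        G.info (fun v => level (ω v)) (2 * G.spDiam + 1) v := by
  classical
  induction t with
  | zero => exact Or.inl fun s hs => absurd hs (Nat.not_lt_zero s)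
  | succ t ih =>
    by_cases hall : ∀ s < t + 1, ∀ v, ¬ (nodeState Q W k level G ω s v).Done Q W
    · exact Or.inl hall
    right
    have hfix := G.info_stable (fun v => level (ω v)) (le_refl (2 * G.spDiam + 1))
    have hrest : ∀ v, (nodeState Q W k level G ω t v).ann.info =
        G.info (fun v => level (ω v)) (2 * G.spDiam + 1) v := by
      rcases ih with ih | ih
      · have hrun := fun v => nodeState_eq_run G ω ih v
        push Not at hall
        obtain ⟨s, hs, w, hw⟩ := hall
        have hst : s = t := by
          by_contra hne
          exact ih s (by omega) w hw
        subst hst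
        rw [hrun] at hw
        rcases hw with hw | hw | hw
        · exact hw.elim
        · exact absurd (hgood s w) hw
        · have hfix' := G.info_fixed_of_clock (fun v => level (ω v)) hw.1 hw.2
          intro v
          rw [hrun v]
          have hc : 2 * (G.run (fun v => level (ω v)) s w).clock + 2 ≤ s := hw.2
          change G.info _ s v = _
          rw [G.info_eq_of_fixed _ hfix' (by omega) v]
          rw [← G.info_eq_of_fixed _ hfix (le_max_left _ s) v,
            ← G.info_eq_of_fixed _ hfix' (le_trans (by omega) (le_max_right _ s)) v]
      · exact ih
    intro v
    by_cases hv : (nodeState Q W k level G ω t v).Done Q W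
    · rw [nodeState_succ_of_done G ω hv, hrest]
    · rw [nodeState_succ_of_not_done G ω hv rfl]
      split_ifs with hj
      · exact hrest v
      · push Not at hj
        conv_rhs => rw [← hfix v, G.info_succ]
        change nextInfo _ _ _ = _
        rw [hrest v, nodeState_input, G.map_byIdent]
        congr 1
        apply G.byIdent_congr
        intro w hw
        have h1 := hj (G.ident w) (by rw [nodeState_input, G.input_nbr hw]; simp)
        rw [G.byIdent_apply hw] at h1
        have h2 : ¬ (nodeState Q W k level G ω t w).Done Q W := by
          intro h2
          rw [if_pos h2] at h1
          exact h1 rfl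
        rw [if_neg h2, Option.map_some, hrest w]

/-- If no announcement is too large, then all nodes compute their sketches. -/
lemma output_nodeState
    (hgood : ∀ t v, (G.run (fun v => level (ω v)) t v).Small Q W) (v : V) :
    (sketchAlg Q W k level).output (nodeState Q W k level G ω (5 * G.spDiam + 4) v) =
      some (sketchOf k (G.info (fun v => level (ω v)) (2 * G.spDiam + 1) v)) := by
  rw [output_sketchAlg_eq_some (all_done G ω v)]
  -- one step later some node has halted, and halted nodes keep their states
  rcases nodeState_cases G ω hgood (5 * G.spDiam + 4 + 1) (k := k) with h | h
  · exact absurd (all_done G ω v) (h _ (Nat.lt_succ_self _) v)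
  · rw [← h v, nodeState_succ_of_done G ω (all_done G ω v)]

end

/-- The sketching algorithm as a message-passing algorithm: its running time for every outcome of
the random choices, and its result if no announcement is too large. -/
lemma exists_distAlg {Q W M : ℕ} (k : ℕ) (level : Tape → ℕ) (hQ : 4 ≤ Q) (hM : M = Q ^ 5) :
    ∃ alg : DistAlg M (CDGSketch k), ∀ (V : Type*) [Fintype V] (G : Network V) (ω : V → Tape),
      alg.HaltedBy G ω ((5 * G.spDiam + 4) * (2 * W + 2)) ∧
      ((∀ t v, (G.run (fun v => level (ω v)) t v).Small Q W) →
        ∀ v, alg.Outputs G ω v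
          (sketchOf k (G.info (fun v => level (ω v)) (2 * G.spDiam + 1) v))) := by
  obtain ⟨code, decode, hcode⟩ := exists_code (W := W) hQ hM
  have hdec : ∀ σ, (sketchAlg Q W k level).output σ = none →
      decode (code ((sketchAlg Q W k level).announce σ)) = (sketchAlg Q W k level).announce σ := by
    intro σ hσ
    exact hcode _ (not_not.1 fun h => (output_sketchAlg_eq_none σ).1 hσ (Or.inr (Or.inl h)))
  refine ⟨(sketchAlg Q W k level).compile code decode, fun V _ G ω => ⟨fun v => ?_, fun h v =>
    ⟨(5 * G.spDiam + 4) * (2 * W + 2), ?_⟩⟩⟩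
  · rw [BroadcastAlg.output_compile _ _ _ hdec (by omega)]
    exact fun h0 => (output_sketchAlg_eq_none _).1 h0 (all_done G ω v)
  · rw [BroadcastAlg.output_compile _ _ _ hdec (by omega)]
    exact output_nodeState G ω h v

/-! ### Announcements are small if no ball contains many nodes of a level -/

namespace Network

variable {V : Type*} (G : Network V)

/-- The nodes that can be reached from `v` with at most `t` edges and at most the weight that is
needed to reach `w` with at most `t` edges. -/
def hopBall (t : ℕ) (v w : V) : Set V :=
  {u | ∀ q : G.graph.Walk v w, q.length ≤ t →
    ∃ p : G.graph.Walk v u, p.length ≤ t ∧ G.walkWeight p ≤ G.walkWeight q}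

variable (r : V → ℕ)

/-- The table of `v` contains few entries of a level if, in every ball around `v`, there is a node of
higher level or there are few nodes of this level or a higher one. -/
lemma ncard_entries_lev_le [Finite V] {t i B : ℕ} {v : V}
    (h : ∀ w, (∃ u ∈ G.hopBall t v w, i + 1 < r u) ∨
      {u | u ∈ G.hopBall t v w ∧ i < r u}.ncard ≤ B) :
    {e | e ∈ (G.info r t v).entries ∧ e.lev = i + 1}.ncard ≤ B := by
  classical
  set E := {e | e ∈ (G.info r t v).entries ∧ e.lev = i + 1} with hE
  have hfin : E.Finite := (G.finite_entries r t v).subset fun _ h => h.1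
  rcases E.eq_empty_or_nonempty with h0 | h0
  · rw [h0, Set.ncard_empty]; exact Nat.zero_le _
  -- the ball reaches up to the farthest source of this level
  obtain ⟨e, he, hmax⟩ := Set.exists_max_image E Entry.dist hfin h0
  have heP := he.1
  rw [entries_eq] at heP
  obtain ⟨⟨w, p, hp, hw, hep⟩, hmin⟩ := heP
  have hlev : e.lev = i + 1 := he.2
  have hlight : ∀ q : G.graph.Walk v w, q.length ≤ t → e.dist ≤ G.walkWeight q := by
    intro q hq
    have := hmin _ ⟨w, q, hq, hw, rfl⟩
    rw [hep, Entry.beats_mk] at this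
    rw [hep]
    simp only
    omega
  rcases h w with ⟨u, hu, hlt⟩ | hle
  · exfalso
    obtain ⟨p', hp', hle'⟩ := hu p hp
    have := hmin _ ⟨u, p', hp', by omega, rfl⟩
    rw [hep] at hlev
    simp only at hlev
    rw [hep, Entry.beats_mk] at this
    omega
  · refine le_trans ?_ hle
    have hsrc : ∀ e' : E, ∃ w', ∃ p' : G.graph.Walk v w', p'.length ≤ t ∧
        e'.1 = ⟨r w', G.ident w', G.walkWeight p', p'.length⟩ := by
      intro e'
      obtain ⟨w', p', -, hp', -, h'⟩ := G.exists_isPath_of_mem_entries r e'.2.1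
      exact ⟨w', p', hp', h'⟩
    choose s hs using hsrc
    refine Set.ncard_le_ncard_of_injOn (fun e' => if h' : e' ∈ E then s ⟨e', h'⟩ else v) ?_ ?_
      (Set.toFinite _)
    · intro e' he'
      simp only [dif_pos he']
      obtain ⟨p', hp', h'⟩ := hs ⟨e', he'⟩
      have h1 := hmax e' he'
      have h2 := he'.2
      simp only at h'
      rw [h'] at h1 h2
      simp only at h1 h2
      exact ⟨fun q hq => ⟨p', hp', h1.trans (hlight q hq)⟩, by omega⟩
    · intro e₁ h₁ e₂ h₂ heq
      simp only [dif_pos h₁, dif_pos h₂] at heq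
      obtain ⟨p₁, -, h₁'⟩ := hs ⟨e₁, h₁⟩
      obtain ⟨p₂, -, h₂'⟩ := hs ⟨e₂, h₂⟩
      refine G.entries_eq_of_id r h₁.1 h₂.1 ?_
      simp only at h₁' h₂'
      rw [h₁', h₂']
      simp only [heq]

variable [Fintype V]

lemma exists_entries_eq [Nonempty V] (t : ℕ) : ∃ s < Fintype.card V, ∀ v,
    (G.info r t v).entries = (G.info r s v).entries := by
  by_cases h : t < Fintype.card V
  · exact ⟨t, h, fun _ => rfl⟩
  · have := G.spDiam_lt_card
    refine ⟨G.spDiam, this, fun v => ?_⟩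
    rw [G.entries_eq_finalEntries r (by omega), G.entries_eq_finalEntries r le_rfl]

variable {r}

lemma small_run {a k B Q : ℕ} (hcard : 2 ≤ Fintype.card V) (hG : G.PolyBounded a)
    (hQ : Fintype.card V ^ (a + 2) ≤ Q) (hrk : ∀ v, r v ≤ k) (hrQ : ∀ v, r v < Q)
    (h : ∀ t < Fintype.card V, ∀ v w, ∀ i < k, (∃ u ∈ G.hopBall t v w, i + 1 < r u) ∨
      {u | u ∈ G.hopBall t v w ∧ i < r u}.ncard ≤ B) (t : ℕ) (v : V) :
    (G.run r t v).Small Q (k * B) := by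
  have : Nonempty V := ⟨v⟩
  have hS := G.spDiam_lt_card
  set n := Fintype.card V with hn
  have hna : n ^ (a + 2) = n ^ a * n * n := by ring
  have hpos : 1 ≤ n ^ a := Nat.one_le_pow _ _ (by omega)
  have h2 : 2 * n ≤ n ^ a * n * n := by
    rw [Nat.mul_assoc]
    exact (Nat.mul_le_mul_right n hcard).trans (Nat.le_mul_of_pos_left _ hpos)
  have h3 : n ^ a * n ≤ n ^ a * n * n := Nat.le_mul_of_pos_right _ (by omega)
  have h4 : n ^ a ≤ n ^ a * n := Nat.le_mul_of_pos_right _ (by omega)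
  have hent : ∀ t v, SmallTable Q (k * B) (G.info r t v).entries := by
    intro t v
    refine ⟨G.finite_entries r t v, ?_, ?_⟩
    · obtain ⟨s, hs, hts⟩ := G.exists_entries_eq r t
      rw [hts v, Set.ncard_eq_toFinset_card _ (G.finite_entries r s v), mul_comm]
      have hmaps : ∀ e ∈ (G.finite_entries r s v).toFinset, e.lev - 1 ∈ Finset.range k := by
        intro e he
        rw [Set.Finite.mem_toFinset] at he
        obtain ⟨w, p, -, -, hw, rfl⟩ := G.exists_isPath_of_mem_entries r he
        have := hrk w
        rw [Finset.mem_range]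
        simp only
        omega
      have hfib : ∀ i ∈ Finset.range k,
          ((G.finite_entries r s v).toFinset.filter fun e => e.lev - 1 = i).card ≤ B := by
        intro i hi
        refine le_trans ?_ (G.ncard_entries_lev_le r fun w =>
          h s hs v w i (Finset.mem_range.1 hi))
        rw [← Set.ncard_coe_finset]
        refine Set.ncard_le_ncard ?_ ((G.finite_entries r s v).subset fun _ h => h.1)
        intro e he
        rw [Finset.mem_coe, Finset.mem_filter, Set.Finite.mem_toFinset] at he
        obtain ⟨w, p, -, -, hw, rfl⟩ := G.exists_isPath_of_mem_entries r he.1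
        refine ⟨he.1, ?_⟩
        have := he.2
        simp only at this ⊢
        omega
      have := Finset.card_le_mul_card_image_of_maps_to hmaps B hfib
      rwa [Finset.card_range] at this
    · intro e he
      obtain ⟨w, p, hp, -, hw, rfl⟩ := G.exists_isPath_of_mem_entries r he
      have h5 := hp.length_lt
      have h6 := G.walkWeight_le_of_polyBounded hG p
      have h7 : p.length * n ^ a < n * n ^ a := Nat.mul_lt_mul_of_pos_right h5 hpos
      have h8 := hG.1 w
      rw [← hn] at h6 h8
      rw [mul_comm n] at h7
      exact ⟨hrQ w, by simp only; omega, by simp only; omega, by simp only; omega⟩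
  refine ⟨?_, ?_, hent t v, ?_⟩
  · obtain ⟨w, -, -, hw⟩ := G.exists_leader_eq r t v
    have := hG.1 w
    rw [← hn] at this
    change (G.info r t v).leader < Q
    omega
  · have := G.clock_le_of_fixed r (T := 2 * G.spDiam + 1) (fun t ht u => G.info_stable r ht u) t v
    omega
  · rcases G.copy_eq_empty_or r t v with h | ⟨s, w, -, h⟩
    · change SmallTable Q _ (G.info r t v).copy
      rw [h]
      exact ⟨Set.finite_empty, by rw [Set.ncard_empty]; exact Nat.zero_le _, fun e he => he.elim⟩
    · change SmallTable Q _ (G.info r t v).copy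
      rw [h]
      exact hent s w

/-- The number of words of the final sketches. -/
lemma words_sketchOf_le {k B : ℕ}
    (h : ∀ t < Fintype.card V, ∀ v w, ∀ i < k, (∃ u ∈ G.hopBall t v w, i + 1 < r u) ∨
      {u | u ∈ G.hopBall t v w ∧ i < r u}.ncard ≤ B) (v : V) :
    (sketchOf k (G.info r (2 * G.spDiam + 1) v)).words ≤ 2 + k * (3 + 2 * B) := by
  have : Nonempty V := ⟨v⟩
  unfold CDGSketch.words TZLabel.words
  refine Nat.add_le_add_left ?_ 2
  have hb : ∀ i : Fin k, ((labelOf k (G.info r (2 * G.spDiam + 1) v).copy).bunch i).length ≤ B := by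
    intro i
    refine (length_bunch_labelOf _ i).trans ?_
    rcases G.copy_eq_empty_or r (2 * G.spDiam + 1) v with h' | ⟨s, w, -, h'⟩
    · rw [h']; simp
    · obtain ⟨s', hs', hss'⟩ := G.exists_entries_eq r s
      rw [h', hss']
      exact G.ncard_entries_lev_le r fun z => h s' hs' w z i i.2
  calc _ ≤ ∑ _i : Fin k, (3 + 2 * B) := Finset.sum_le_sum fun i _ => by
        have := hb i
        change 2 + 1 + 2 * ((labelOf k (G.info r (2 * G.spDiam + 1) v).copy).bunch i).length ≤ _
        omega
    _ = _ := by simp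

end Network

/-! ### The random hierarchy -/

instance (V : Type*) [Fintype V] : IsProbabilityMeasure (tapeMeasure V) := by
  unfold tapeMeasure; infer_instance

/-- The law of the random source of one node. -/
noncomputable def singleTapeMeasure : Measure Tape :=
  Measure.infinitePi fun _ : ℕ => (volume : Measure unitInterval)

instance : IsProbabilityMeasure singleTapeMeasure := by
  unfold singleTapeMeasure; infer_instance

/-- The exponential-moment bound: functions of the random sources of different nodes are
independent. -/
lemma mul_tapeMeasure_le {V : Type*} [Fintype V] (J : Finset V) {f : Tape → ENNReal}
    (hf : Measurable f) {θ : ENNReal} {D : Set (V → Tape)}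
    (hD : ∀ ω ∈ D, θ ≤ ∏ v ∈ J, f (ω v)) :
    θ * tapeMeasure V D ≤ (∫⁻ τ, f τ ∂singleTapeMeasure) ^ J.card := by
  have hmeas : ∀ v : V, Measurable fun ω : V → Tape => f (ω v) := fun v =>
    hf.comp (measurable_pi_apply v)
  have hind : ProbabilityTheory.iIndepFun (fun (v : V) (ω : V → Tape) => f (ω v))
      (tapeMeasure V) :=
    ProbabilityTheory.iIndepFun_pi fun _ => hf.aemeasurable
  have hint : ∫⁻ ω, ∏ v ∈ J, f (ω v) ∂tapeMeasure V =
      (∫⁻ τ, f τ ∂singleTapeMeasure) ^ J.card := by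
    rw [ProbabilityTheory.lintegral_prod_eq_prod_lintegral_of_indepFun J _ hind hmeas]
    have : ∀ v : V, ∫⁻ ω, f (ω v) ∂tapeMeasure V = ∫⁻ τ, f τ ∂singleTapeMeasure := fun v =>
      (measurePreserving_eval (fun _ : V => singleTapeMeasure) v).lintegral_comp hf
    simp [this]
  rw [← hint]
  calc θ * tapeMeasure V D ≤ θ * tapeMeasure V {ω | θ ≤ ∏ v ∈ J, f (ω v)} := by
        gcongr
        exact hD
    _ ≤ _ := mul_meas_ge_le_lintegral (Finset.measurable_prod J fun v _ => hmeas v) θ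

lemma volume_le_eq {c : ℝ} (hc : 0 ≤ c) :
    (volume : Measure unitInterval) {x | (x : ℝ) ≤ c} = ENNReal.ofReal (min 1 c) := by
  by_cases h : 1 ≤ c
  · rw [min_eq_left h]
    have : {x : unitInterval | (x : ℝ) ≤ c} = Set.univ :=
      Set.eq_univ_of_forall fun x => x.2.2.trans h
    rw [this]; simp
  · rw [min_eq_right (not_le.1 h).le]
    exact unitInterval.volume_Iic ⟨c, hc, (not_le.1 h).le⟩

/-- The random sources with which a node belongs to the `i`-th set of a hierarchy that starts with
probability `q` and continues with probability `p`. -/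
def levelSet (q p : ℝ) (i : ℕ) : Set Tape := {τ | (τ 0 : ℝ) ≤ q ∧ ∀ j < i, (τ (j + 1) : ℝ) ≤ p}

lemma measurableSet_levelSet (q p : ℝ) (i : ℕ) : MeasurableSet (levelSet q p i) := by
  have : levelSet q p i = {τ : Tape | (τ 0 : ℝ) ≤ q} ∩
      ⋂ j ∈ Finset.range i, {τ : Tape | (τ (j + 1) : ℝ) ≤ p} := by
    ext τ; simp [levelSet]
  rw [this]
  have hm : ∀ (j : ℕ) (c : ℝ), MeasurableSet {τ : Tape | (τ j : ℝ) ≤ c} := fun j c =>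
    measurableSet_le (measurable_subtype_coe.comp (measurable_pi_apply j)) measurable_const
  exact (hm 0 q).inter (Finset.measurableSet_biInter _ fun j _ => hm _ p)

lemma levelSet_succ_subset (q p : ℝ) (i : ℕ) : levelSet q p (i + 1) ⊆ levelSet q p i :=
  fun _ h => ⟨h.1, fun j hj => h.2 j (by omega)⟩

/-- The law of a tape gives a box with sides `s j` the product of the measures of the sides. -/
lemma singleTapeMeasure_box (m : ℕ) (s : ℕ → Set unitInterval) (hs : ∀ j, MeasurableSet (s j)) :
    singleTapeMeasure {τ | ∀ j < m, τ j ∈ s j} = ∏ j ∈ Finset.range m, volume (s j) := by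
  have : {τ : Tape | ∀ j < m, τ j ∈ s j} = Set.pi (Finset.range m) s := by
    ext τ; simp [Set.mem_pi]
  rw [this]
  exact Measure.infinitePi_pi _ fun j _ => hs j

lemma measurableSet_coe_le (c : ℝ) : MeasurableSet {x : unitInterval | (x : ℝ) ≤ c} :=
  measurableSet_le measurable_subtype_coe measurable_const

section

variable {q p : ℝ} (hq : 0 ≤ q) (hp0 : 0 ≤ p) (hp1 : p ≤ 1)

include hq hp0 hp1

lemma singleTapeMeasure_levelSet (i : ℕ) :
    singleTapeMeasure (levelSet q p i) = ENNReal.ofReal (min 1 q * p ^ i) := by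
  let s : ℕ → Set unitInterval := fun j => if j = 0 then {x | (x : ℝ) ≤ q} else {x | (x : ℝ) ≤ p}
  have hs : ∀ j, MeasurableSet (s j) := by
    intro j
    dsimp only [s]
    split_ifs
    · exact measurableSet_coe_le q
    · exact measurableSet_coe_le p
  have h : levelSet q p i = {τ | ∀ j < i + 1, τ j ∈ s j} := by
    ext τ
    constructor
    · rintro ⟨h0, h1⟩ j hj
      rcases j with _ | j
      · simpa [s] using h0
      · simpa [s] using h1 j (by omega)
    · intro h
      exact ⟨by simpa [s] using h 0 (by omega), fun j hj => by simpa [s] using h (j + 1) (by omega)⟩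
  rw [h, singleTapeMeasure_box _ _ hs, Finset.prod_range_succ', mul_comm]
  have h1 : ∀ j, volume (s (j + 1)) = ENNReal.ofReal p := fun j => by
    simp only [s, Nat.succ_ne_zero, if_false]
    rw [volume_le_eq hp0, min_eq_right hp1]
  have h2 : volume (s 0) = ENNReal.ofReal (min 1 q) := by
    simp only [s, if_true]
    rw [volume_le_eq hq]
  simp only [h1, h2, Finset.prod_const, Finset.card_range]
  rw [ENNReal.ofReal_mul (le_min zero_le_one hq), ENNReal.ofReal_pow hp0]

lemma singleTapeMeasure_levelSet_diff (i : ℕ) :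
    singleTapeMeasure (levelSet q p i \ levelSet q p (i + 1)) =
      singleTapeMeasure (levelSet q p i) * ENNReal.ofReal (1 - p) := by
  rw [measure_sdiff (levelSet_succ_subset q p i) (measurableSet_levelSet q p _).nullMeasurableSet
    (measure_ne_top _ _), singleTapeMeasure_levelSet hq hp0 hp1,
    singleTapeMeasure_levelSet hq hp0 hp1,
    ← ENNReal.ofReal_sub _ (mul_nonneg (le_min zero_le_one hq) (pow_nonneg hp0 _)),
    ← ENNReal.ofReal_mul (mul_nonneg (le_min zero_le_one hq) (pow_nonneg hp0 _))]
  congr 1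
  ring

variable {V : Type*} [Fintype V]

open Classical in
/-- It is unlikely that a fixed set contains many nodes of a level but no node of the next one: the
product over the set of the weights `1` (not on the level), `1 / (1 - p)` (on the level but not on
the next one) and `0` (on the next level) has mean `1`. -/
lemma tapeMeasure_no_promotion_le (hp : p < 1) (J : Finset V) (i B : ℕ) :
    tapeMeasure V {ω | (∀ u ∈ J, ω u ∉ levelSet q p (i + 1)) ∧
      B < (J.filter fun u => ω u ∈ levelSet q p i).card} ≤ ENNReal.ofReal ((1 - p) ^ B) := by
  set s := ENNReal.ofReal (1 - p) with hs
  have hs0 : s ≠ 0 := by rw [hs]; simpa using hp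
  have hst : s ≠ ⊤ := ENNReal.ofReal_ne_top
  have hs1 : s ≤ 1 := by rw [hs, ENNReal.ofReal_le_one]; linarith
  let f : Tape → ENNReal := fun τ => (levelSet q p i)ᶜ.indicator 1 τ +
    (levelSet q p i \ levelSet q p (i + 1)).indicator (fun _ => s⁻¹) τ
  have hm := measurableSet_levelSet q p
  have hf : Measurable f := ((measurable_const (a := (1 : ENNReal))).indicator (hm i).compl).add
    (measurable_const.indicator ((hm i).diff (hm (i + 1))))
  have hint : ∫⁻ τ, f τ ∂singleTapeMeasure = 1 := by
    dsimp only [f]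
    rw [lintegral_add_right _ (measurable_const.indicator ((hm i).diff (hm (i + 1)))),
      lintegral_indicator_one (hm i).compl,
      lintegral_indicator_const ((hm i).diff (hm (i + 1))),
      singleTapeMeasure_levelSet_diff hq hp0 hp1, mul_left_comm, ENNReal.inv_mul_cancel hs0 hst,
      mul_one, add_comm, prob_add_prob_compl (hm i)]
  have key := mul_tapeMeasure_le J hf (θ := (s⁻¹) ^ B)
    (D := {ω | (∀ u ∈ J, ω u ∉ levelSet q p (i + 1)) ∧
      B < (J.filter fun u => ω u ∈ levelSet q p i).card}) (by
    rintro ω ⟨h1, h2⟩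
    have hfu : ∀ u ∈ J, f (ω u) = if ω u ∈ levelSet q p i then s⁻¹ else 1 := by
      intro u hu
      have := h1 u hu
      by_cases h : ω u ∈ levelSet q p i <;> simp [f, h, this]
    rw [Finset.prod_congr rfl hfu, Finset.prod_ite, Finset.prod_const, Finset.prod_const, one_pow,
      mul_one]
    exact pow_le_pow_right₀ (ENNReal.one_le_inv.2 hs1) h2.le)
  rw [hint, one_pow, ← ENNReal.inv_pow] at key
  rw [ENNReal.ofReal_pow (by linarith), ← hs]
  calc _ = s ^ B * ((s ^ B)⁻¹ * _) := by
        rw [← mul_assoc, ENNReal.mul_inv_cancel (pow_ne_zero _ hs0) (ENNReal.pow_ne_top hst),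
          one_mul]
    _ ≤ s ^ B * 1 := by gcongr
    _ = s ^ B := mul_one _

open Classical in
/-- The exponential-moment bound for the number of nodes of a level in a fixed set. -/
lemma mul_tapeMeasure_many_le (J : Finset V) (i : ℕ) (x : ℝ) :
    ENNReal.ofReal (2 ^ x) *
      tapeMeasure V {ω | x < (J.filter fun u => ω u ∈ levelSet q p i).card} ≤
      ENNReal.ofReal (Real.exp (Fintype.card V * (min 1 q * p ^ i))) := by
  let f : Tape → ENNReal := fun τ => 1 + (levelSet q p i).indicator 1 τ
  have hm := measurableSet_levelSet q p
  have hmi : Measurable ((levelSet q p i).indicator (1 : Tape → ENNReal)) :=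
    (measurable_const (a := (1 : ENNReal))).indicator (hm i)
  have hf : Measurable f := measurable_const.add hmi
  have hx0 : 0 ≤ min 1 q * p ^ i := mul_nonneg (le_min zero_le_one hq) (pow_nonneg hp0 _)
  have hint : ∫⁻ τ, f τ ∂singleTapeMeasure = ENNReal.ofReal (1 + min 1 q * p ^ i) := by
    dsimp only [f]
    rw [lintegral_add_left measurable_const, lintegral_indicator_one (hm i),
      singleTapeMeasure_levelSet hq hp0 hp1, lintegral_const, measure_univ, one_mul,
      ENNReal.ofReal_add zero_le_one hx0, ENNReal.ofReal_one]
  refine (mul_tapeMeasure_le J hf (θ := ENNReal.ofReal (2 ^ x)) ?_).trans ?_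
  · intro ω hω
    have hfu : ∀ u ∈ J, f (ω u) = if ω u ∈ levelSet q p i then 2 else 1 := by
      intro u hu
      by_cases h : ω u ∈ levelSet q p i
      · simp [f, h, one_add_one_eq_two]
      · simp [f, h]
    rw [Finset.prod_congr rfl hfu, Finset.prod_ite, Finset.prod_const, Finset.prod_const, one_pow,
      mul_one]
    have h2 : (2 : ENNReal) = ENNReal.ofReal 2 := by simp
    rw [h2, ← ENNReal.ofReal_pow (by norm_num)]
    apply ENNReal.ofReal_le_ofReal
    rw [← Real.rpow_natCast]
    exact Real.rpow_le_rpow_of_exponent_le (by norm_num) (le_of_lt hω)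
  · rw [hint, ← ENNReal.ofReal_pow (by linarith)]
    apply ENNReal.ofReal_le_ofReal
    calc (1 + min 1 q * p ^ i) ^ J.card ≤ (1 + min 1 q * p ^ i) ^ Fintype.card V :=
          pow_le_pow_right₀ (by linarith) (Finset.card_le_univ J)
      _ ≤ Real.exp (min 1 q * p ^ i) ^ Fintype.card V := by
          gcongr
          rw [add_comm]
          exact Real.add_one_le_exp _
      _ = _ := by rw [← Real.exp_nat_mul]

lemma tapeMeasure_avoid_le (J : Finset V) :
    tapeMeasure V {ω | ∀ u ∈ J, ω u ∉ levelSet q p 0} ≤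
      ENNReal.ofReal ((1 - min 1 q) ^ J.card) := by
  have hm := measurableSet_levelSet q p 0
  have hmi : Measurable ((levelSet q p 0)ᶜ.indicator (1 : Tape → ENNReal)) :=
    (measurable_const (a := (1 : ENNReal))).indicator hm.compl
  have key := mul_tapeMeasure_le J hmi (θ := 1)
    (D := {ω : V → Tape | ∀ u ∈ J, ω u ∉ levelSet q p 0}) (by
    intro ω hω
    rw [Finset.prod_congr rfl fun u hu => Set.indicator_of_mem (hω u hu) _]
    simp)
  rw [one_mul, lintegral_indicator_one hm.compl, prob_compl_eq_one_sub hm,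
    singleTapeMeasure_levelSet hq hp0 hp1, pow_zero, mul_one, ← ENNReal.ofReal_one,
    ← ENNReal.ofReal_sub _ (le_min zero_le_one hq),
    ← ENNReal.ofReal_pow (by linarith [min_le_left 1 q])] at key
  exact key

lemma tapeMeasure_exists_le (i : ℕ) :
    tapeMeasure V {ω | ∃ v, ω v ∈ levelSet q p i} ≤
      ENNReal.ofReal (Fintype.card V * p ^ i) := by
  have : {ω : V → Tape | ∃ v, ω v ∈ levelSet q p i} = ⋃ v, {ω | ω v ∈ levelSet q p i} := by
    ext; simp
  rw [this]
  refine (measure_iUnion_fintype_le _ _).trans ?_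
  have h1 : ∀ v : V, tapeMeasure V {ω | ω v ∈ levelSet q p i} =
      singleTapeMeasure (levelSet q p i) := fun v =>
    (measurePreserving_eval (fun _ : V => singleTapeMeasure) v).measure_preimage
      (measurableSet_levelSet q p i).nullMeasurableSet
  simp only [h1, singleTapeMeasure_levelSet hq hp0 hp1]
  rw [Finset.sum_const, Finset.card_univ, nsmul_eq_mul, ENNReal.ofReal_mul (Nat.cast_nonneg _),
    ENNReal.ofReal_natCast]
  gcongr
  have := min_le_left 1 q
  nlinarith [pow_nonneg hp0 i]

end

/-! ### Failure probabilities -/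

/-- The number of sets of the hierarchy with `k` sets that a node with random source `τ` belongs
to. -/
noncomputable def hierarchyLevel (q p : ℝ) (k : ℕ) (τ : Tape) : ℕ :=
  sInf {i | ¬ (i < k ∧ τ ∈ levelSet q p i)}

lemma levelSet_antitone (q p : ℝ) : Antitone (levelSet q p) :=
  antitone_nat_of_succ_le (levelSet_succ_subset q p)

lemma lt_hierarchyLevel_iff {q p : ℝ} {k i : ℕ} {τ : Tape} :
    i < hierarchyLevel q p k τ ↔ i < k ∧ τ ∈ levelSet q p i := by
  have hne : {i | ¬ (i < k ∧ τ ∈ levelSet q p i)}.Nonempty := ⟨k, fun h => lt_irrefl _ h.1⟩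
  constructor
  · intro h
    exact not_not.1 (Nat.notMem_of_lt_sInf h)
  · intro h
    by_contra hcon
    have h1 : hierarchyLevel q p k τ ≤ i := not_lt.1 hcon
    exact Nat.sInf_mem hne ⟨lt_of_le_of_lt h1 h.1, levelSet_antitone q p h1 h.2⟩

lemma sampledHierarchy_eq {V : Type*} [Fintype V] (ε : ℝ) (k : ℕ) (ω : V → Tape) (i : ℕ) :
    sampledHierarchy ε k ω i = {v | i < hierarchyLevel
      (5 * Real.log (Fintype.card V) / (ε * (Fintype.card V : ℝ)))
      ((10 / ε * Real.log (Fintype.card V)) ^ (-(1 / (k : ℝ)))) k (ω v)} := by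
  ext v
  rw [Set.mem_ofPred_eq, lt_hierarchyLevel_iff]
  rfl

lemma exp_neg_mul_log {n : ℝ} (hn : 0 < n) (m : ℕ) :
    Real.exp (-(m * Real.log n)) = (n ^ m)⁻¹ := by
  rw [Real.exp_neg, Real.exp_nat_mul, Real.exp_log hn]

lemma le_ofReal_div {P : ENNReal} {θ E : ℝ} (hθ : 0 < θ)
    (h : ENNReal.ofReal θ * P ≤ ENNReal.ofReal E) : P ≤ ENNReal.ofReal (E / θ) := by
  rw [ENNReal.ofReal_div_of_pos hθ, ENNReal.le_div_iff_mul_le (Or.inl (by simpa using hθ))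
    (Or.inl ENNReal.ofReal_ne_top), mul_comm]
  exact h

lemma one_half_lt_log {n : ℕ} (hn : 2 ≤ n) : 0.69 < Real.log n := by
  have h1 : Real.log 2 ≤ Real.log n := Real.log_le_log (by norm_num) (by exact_mod_cast hn)
  have := Real.log_two_gt_d9
  linarith

/-- A set of at least `ε * n` nodes is missed by the net with probability at most `n ^ (-5)`. -/
lemma one_sub_min_pow_le {n : ℕ} (hn : 2 ≤ n) {ε : ℝ} (hε : 0 < ε) {j : ℕ} (hj : ε * n ≤ j) :
    (1 - min 1 (5 * Real.log n / (ε * n))) ^ j ≤ (((n : ℝ)) ^ 5)⁻¹ := by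
  have hn0 : (0 : ℝ) < n := by exact_mod_cast (by omega : 0 < n)
  have hεn : 0 < ε * n := mul_pos hε hn0
  have hlog := one_half_lt_log hn
  set q := 5 * Real.log n / (ε * n) with hq
  have hq0 : 0 ≤ q := by positivity
  have hj0 : j ≠ 0 := by
    rintro rfl
    rw [Nat.cast_zero] at hj
    linarith
  rcases le_or_gt 1 q with h | h
  · rw [min_eq_left h, sub_self, zero_pow hj0]
    positivity
  · rw [min_eq_right h.le]
    calc (1 - q) ^ j ≤ Real.exp (-q) ^ j := by
          have := Real.add_one_le_exp (-q)
          exact pow_le_pow_left₀ (by linarith) (by linarith) j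
      _ = Real.exp (-(q * j)) := by rw [← Real.exp_nat_mul]; congr 1; ring
      _ ≤ Real.exp (-((5 : ℕ) * Real.log n)) := by
          apply Real.exp_le_exp.2
          have h1 : q * (ε * n) ≤ q * j := mul_le_mul_of_nonneg_left hj hq0
          have h2 : q * (ε * n) = 5 * Real.log n := div_mul_cancel₀ _ hεn.ne'
          push_cast
          linarith
      _ = _ := exp_neg_mul_log hn0 5

/-- The numerical estimate behind the bound on the size of the net. -/
lemma exp_sub_le {n : ℕ} (hn : 2 ≤ n) {y : ℝ} (hy : 5 * Real.log n ≤ y) :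
    Real.exp y / 2 ^ (2 * y) ≤ 5 / 9 * (n : ℝ)⁻¹ := by
  have hn0 : (0 : ℝ) < n := by exact_mod_cast (by omega : 0 < n)
  have hlog := one_half_lt_log hn
  have h2 := Real.log_two_gt_d9
  have hlog2 : Real.log 2 ≤ Real.log n := Real.log_le_log (by norm_num) (by exact_mod_cast hn)
  have h95 : Real.log (9 / 5) ≤ 0.9 * Real.log 2 := by
    have h : Real.log ((9 / 5 : ℝ) ^ 10) ≤ Real.log ((2 : ℝ) ^ 9) :=
      Real.log_le_log (by norm_num) (by norm_num)
    rw [Real.log_pow, Real.log_pow] at h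
    push_cast at h
    linarith
  have h59 : (5 / 9 : ℝ) = Real.exp (-Real.log (9 / 5)) := by
    rw [Real.exp_neg, Real.exp_log (by norm_num)]; norm_num
  have hninv : (n : ℝ)⁻¹ = Real.exp (-Real.log n) := by
    rw [Real.exp_neg, Real.exp_log hn0]
  rw [Real.rpow_def_of_pos (by norm_num), ← Real.exp_sub, h59, hninv, ← Real.exp_add]
  apply Real.exp_le_exp.2
  nlinarith

section

variable {n : ℕ} (hn : 2 ≤ n) {p : ℝ} (hp0 : 0 < p) (hp1 : p < 1) {m B : ℕ} (hm : 8 ≤ m)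
  (hB : 2 * m * Real.log n / p ≤ B)

include hn hp0 hp1 hm hB

lemma one_sub_pow_le : (1 - p) ^ B ≤ ((n : ℝ) ^ m)⁻¹ := by
  have hn0 : (0 : ℝ) < n := by exact_mod_cast (by omega : 0 < n)
  have hlog := one_half_lt_log hn
  rw [← exp_neg_mul_log hn0 m]
  calc (1 - p) ^ B ≤ Real.exp (-p) ^ B := by
        have := Real.add_one_le_exp (-p)
        exact pow_le_pow_left₀ (by linarith) (by linarith) B
    _ = Real.exp (-(B * p)) := by rw [← Real.exp_nat_mul]; congr 1; ring
    _ ≤ _ := by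
        apply Real.exp_le_exp.2
        rw [div_le_iff₀ hp0] at hB
        have : 0 ≤ (m : ℝ) * Real.log n := by positivity
        linarith

lemma exp_div_two_pow_le : Real.exp (1 / (2 * p)) / 2 ^ (B : ℝ) ≤ ((n : ℝ) ^ m)⁻¹ := by
  have hn0 : (0 : ℝ) < n := by exact_mod_cast (by omega : 0 < n)
  have hlog := one_half_lt_log hn
  have h2 := Real.log_two_gt_d9
  have hm' : (8 : ℝ) ≤ m := by exact_mod_cast hm
  rw [← exp_neg_mul_log hn0 m, Real.rpow_def_of_pos (by norm_num), ← Real.exp_sub]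
  apply Real.exp_le_exp.2
  have hmx : 8 * 0.69 ≤ m * Real.log n := by
    apply mul_le_mul hm' hlog.le (by norm_num) (by positivity)
  have hp' : 1 ≤ 1 / p := by rw [le_div_iff₀ hp0]; linarith
  have e1 : 1 / (2 * p) = 1 / p * (1 / 2) := by field_simp
  have e2 : 2 * m * Real.log n / p = 1 / p * (2 * (m * Real.log n)) := by field_simp
  rw [e2] at hB
  rw [e1]
  have h3 : Real.log 2 * (1 / p * (2 * (m * Real.log n))) ≤ Real.log 2 * B :=
    mul_le_mul_of_nonneg_left hB (by linarith)
  have h4 : m * Real.log n ≤ Real.log 2 * (2 * (m * Real.log n)) - 1 / 2 := by nlinarith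
  have h5 : m * Real.log n ≤ 1 / p * (Real.log 2 * (2 * (m * Real.log n)) - 1 / 2) :=
    h4.trans (le_mul_of_one_le_left (by linarith) hp')
  nlinarith

end

lemma ncard_ball_densityRadius {V : Type*} [Fintype V] (G : Network V) (u : V) {ε : ℝ}
    (hε : ε ≤ 1) : ε * (Fintype.card V : ℝ) ≤
      (({v | (G.dist u v : ℝ) ≤ G.densityRadius u ε} : Set V).ncard : ℝ) := by
  set T := {r : ℝ | 0 ≤ r ∧
    ε * (Fintype.card V : ℝ) ≤ (({v | (G.dist u v : ℝ) ≤ r} : Set V).ncard : ℝ)} with hT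
  have hne : T.Nonempty := by
    refine ⟨((Finset.univ.sup (G.dist u) : ℕ) : ℝ), Nat.cast_nonneg _, ?_⟩
    have : {v | (G.dist u v : ℝ) ≤ ((Finset.univ.sup (G.dist u) : ℕ) : ℝ)} = Set.univ :=
      Set.eq_univ_of_forall fun v =>
        (Nat.cast_le (α := ℝ)).2 (Finset.le_sup (f := G.dist u) (Finset.mem_univ v))
    rw [this, Set.ncard_univ, Nat.card_eq_fintype_card]
    exact mul_le_of_le_one_left (Nat.cast_nonneg _) hε
  -- distances are integers, so the infimum is attained
  obtain ⟨r, hr, hlt⟩ := exists_lt_of_csInf_lt hne (Nat.lt_floor_add_one (sInf T))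
  refine hr.2.trans (Nat.cast_le.2 (Set.ncard_le_ncard (fun v hv => ?_) (Set.toFinite _)))
  have h1 : (G.dist u v : ℝ) < (⌊sInf T⌋₊ : ℝ) + 1 := lt_of_le_of_lt hv hlt
  have h2 : G.dist u v ≤ ⌊sInf T⌋₊ := Nat.lt_succ_iff.1 (by exact_mod_cast h1)
  exact (Nat.cast_le.2 h2).trans (Nat.floor_le (Real.sInf_nonneg fun r hr => hr.1))

section

variable {V : Type*} [Fintype V] (G : Network V) {n k : ℕ} {ε : ℝ} (hV : Fintype.card V = n)
  (hn : 2 ≤ n) {p : ℝ} (hp0 : 0 < p) (hp1 : p < 1)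

include hV hn hp0 hp1

lemma tapeMeasure_not_isDensityNet_le (hε0 : 0 < ε) (hε1 : ε < 1) (hk : 1 ≤ k) :
    tapeMeasure V {ω | ¬ G.IsDensityNet ε
      {v | 0 < hierarchyLevel (5 * Real.log n / (ε * n)) p k (ω v)}} ≤
      ENNReal.ofReal (((n : ℝ) ^ 4)⁻¹ + 5 / 9 * (n : ℝ)⁻¹) := by
  classical
  set q := 5 * Real.log n / (ε * n) with hq
  have hn0 : (0 : ℝ) < n := by exact_mod_cast (by omega : 0 < n)
  have hlog := one_half_lt_log hn
  have hq0 : 0 ≤ q := by positivity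
  have hlev : ∀ τ, 0 < hierarchyLevel q p k τ ↔ τ ∈ levelSet q p 0 := fun τ => by
    rw [lt_hierarchyLevel_iff]; exact and_iff_right (by omega)
  let J : V → Finset V := fun u => {v | (G.dist u v : ℝ) ≤ G.densityRadius u ε}.toFinset
  let D₁ : V → Set (V → Tape) := fun u => {ω | ∀ v ∈ J u, ω v ∉ levelSet q p 0}
  let D₂ : Set (V → Tape) := {ω | 2 * (5 * Real.log n / ε) <
    ((Finset.univ.filter fun u => ω u ∈ levelSet q p 0).card : ℝ)}
  have hsub : {ω : V → Tape | ¬ G.IsDensityNet ε {v | 0 < hierarchyLevel q p k (ω v)}} ⊆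
      (⋃ u, D₁ u) ∪ D₂ := by
    intro ω hω
    by_contra hcon
    apply hω
    rw [Set.mem_union, Set.mem_iUnion, not_or, not_exists] at hcon
    refine ⟨fun u => ?_, ?_⟩
    · have := hcon.1 u
      simp only [D₁, Set.mem_ofPred_eq, not_forall, not_not] at this
      obtain ⟨v, hv, hvl⟩ := this
      exact ⟨v, (hlev _).2 hvl, by simpa [J] using hv⟩
    · have h2 : ((Finset.univ.filter fun u => ω u ∈ levelSet q p 0).card : ℝ) ≤
          2 * (5 * Real.log n / ε) := not_lt.1 hcon.2
      rw [hV]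
      have h3 : ({v | 0 < hierarchyLevel q p k (ω v)} : Set V).ncard =
          (Finset.univ.filter fun u => ω u ∈ levelSet q p 0).card := by
        rw [← Set.ncard_coe_finset]
        congr 1
        ext v
        simp [hlev]
      rw [h3]
      refine h2.trans (le_of_eq ?_)
      ring
  have hJ : ∀ u, tapeMeasure V (D₁ u) ≤ ENNReal.ofReal (((n : ℝ) ^ 5)⁻¹) := by
    intro u
    refine (tapeMeasure_avoid_le hq0 hp0.le hp1.le (J u)).trans (ENNReal.ofReal_le_ofReal ?_)
    apply one_sub_min_pow_le hn hε0
    have := ncard_ball_densityRadius G u hε1.le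
    rw [hV, Set.ncard_eq_toFinset_card'] at this
    exact this
  have hD₂ : tapeMeasure V D₂ ≤ ENNReal.ofReal (5 / 9 * (n : ℝ)⁻¹) := by
    have h1 := mul_tapeMeasure_many_le hq0 hp0.le hp1.le (Finset.univ : Finset V) 0
      (2 * (5 * Real.log n / ε))
    refine (le_ofReal_div (by positivity) h1).trans (ENNReal.ofReal_le_ofReal ?_)
    have hy : 5 * Real.log n ≤ 5 * Real.log n / ε := by
      rw [le_div_iff₀ hε0]
      nlinarith
    refine le_trans ?_ (exp_sub_le hn hy)
    gcongr
    rw [hV, pow_zero, mul_one]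
    calc (n : ℝ) * min 1 q ≤ n * q := by gcongr; exact min_le_right _ _
      _ = 5 * Real.log n / ε := by rw [hq]; field_simp
  calc _ ≤ tapeMeasure V ((⋃ u, D₁ u) ∪ D₂) := measure_mono hsub
    _ ≤ tapeMeasure V (⋃ u, D₁ u) + tapeMeasure V D₂ := measure_union_le _ _
    _ ≤ ∑ u, tapeMeasure V (D₁ u) + tapeMeasure V D₂ := by
        gcongr; exact measure_iUnion_fintype_le _ _
    _ ≤ ∑ _u : V, ENNReal.ofReal (((n : ℝ) ^ 5)⁻¹) + ENNReal.ofReal (5 / 9 * (n : ℝ)⁻¹) := by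
        gcongr with u
        exact hJ u
    _ = ENNReal.ofReal (n * ((n : ℝ) ^ 5)⁻¹) + ENNReal.ofReal (5 / 9 * (n : ℝ)⁻¹) := by
        rw [Finset.sum_const, Finset.card_univ, hV, nsmul_eq_mul,
          ENNReal.ofReal_mul (Nat.cast_nonneg _), ENNReal.ofReal_natCast]
    _ = _ := by
        rw [← ENNReal.ofReal_add (by positivity) (by positivity)]
        congr 2
        field_simp

lemma tapeMeasure_high_level_le {Λ : ℕ} (hΛ : p ^ Λ ≤ ((n : ℝ) ^ 6)⁻¹) (q : ℝ) (hq0 : 0 ≤ q) :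
    tapeMeasure V {ω | ∃ v, Λ < hierarchyLevel q p k (ω v)} ≤
      ENNReal.ofReal (((n : ℝ) ^ 5)⁻¹) := by
  have hn0 : (0 : ℝ) < n := by exact_mod_cast (by omega : 0 < n)
  calc _ ≤ tapeMeasure V {ω | ∃ v, ω v ∈ levelSet q p Λ} := by
        apply measure_mono
        rintro ω ⟨v, hv⟩
        exact ⟨v, (lt_hierarchyLevel_iff.1 hv).2⟩
    _ ≤ _ := tapeMeasure_exists_le hq0 hp0.le hp1.le Λ
    _ ≤ _ := by
        apply ENNReal.ofReal_le_ofReal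
        rw [hV]
        calc (n : ℝ) * p ^ Λ ≤ n * ((n : ℝ) ^ 6)⁻¹ := by gcongr
          _ = _ := by field_simp

/-- A fixed set is unlikely to contain many nodes of a level without a node of the next level.  On
the last level this is so because the whole level is small. -/
lemma tapeMeasure_crowded_le (hε0 : 0 < ε) {m B : ℕ} (hm : 8 ≤ m) (hB : 2 * m * Real.log n / p ≤ B)
    (hpk : p ^ k = (10 / ε * Real.log n)⁻¹) (S : Set V) {i : ℕ} (hik : i < k) :
    tapeMeasure V {ω | ¬ ((∃ u ∈ S, i + 1 < hierarchyLevel (5 * Real.log n / (ε * n)) p k (ω u)) ∨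
      {u | u ∈ S ∧ i < hierarchyLevel (5 * Real.log n / (ε * n)) p k (ω u)}.ncard ≤ B)} ≤
      ENNReal.ofReal (((n : ℝ) ^ m)⁻¹) := by
  classical
  set q := 5 * Real.log n / (ε * n) with hq
  have hn0 : (0 : ℝ) < n := by exact_mod_cast (by omega : 0 < n)
  have hlog := one_half_lt_log hn
  have hq0 : 0 ≤ q := by positivity
  have hcount : ∀ ω : V → Tape, {u | u ∈ S ∧ i < hierarchyLevel q p k (ω u)}.ncard =
      (S.toFinset.filter fun u => ω u ∈ levelSet q p i).card := by
    intro ω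
    rw [← Set.ncard_coe_finset]
    congr 1
    ext u
    simp [lt_hierarchyLevel_iff, hik]
  rcases Nat.lt_or_ge (i + 1) k with hi | hi
  · refine (measure_mono ?_).trans ((tapeMeasure_no_promotion_le hq0 hp0.le hp1.le hp1
      S.toFinset i B).trans (ENNReal.ofReal_le_ofReal (one_sub_pow_le hn hp0 hp1 hm hB)))
    intro ω hω
    simp only [Set.mem_ofPred_eq, not_or, not_exists, not_and, not_le, hcount] at hω
    refine ⟨fun u hu hul => hω.1 u (Set.mem_toFinset.1 hu) ?_, hω.2⟩
    exact lt_hierarchyLevel_iff.2 ⟨hi, hul⟩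
  · obtain rfl : k = i + 1 := by omega
    have h1 := mul_tapeMeasure_many_le hq0 hp0.le hp1.le S.toFinset i B
    refine (measure_mono ?_).trans ((le_ofReal_div (by positivity) h1).trans
      (ENNReal.ofReal_le_ofReal (le_trans ?_ (exp_div_two_pow_le hn hp0 hp1 hm hB))))
    · intro ω hω
      simp only [Set.mem_ofPred_eq, not_or, not_le, hcount] at hω
      exact (Nat.cast_lt (α := ℝ)).2 hω.2
    · gcongr
      rw [hV]
      calc (n : ℝ) * (min 1 q * p ^ i) ≤ n * (q * p ^ i) := by
            gcongr; exact min_le_right _ _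
        _ = 5 * Real.log n / ε * p ^ (i + 1) / p := by
            rw [hq, pow_succ]; field_simp
        _ = 1 / (2 * p) := by
            rw [hpk]; field_simp; norm_num

/-- With probability at least `1 - 1 / n`, the set of all nodes of positive level is a density net,
no level is high, and no ball is crowded. -/
lemma tapeMeasure_bad_le (hε0 : 0 < ε) (hε1 : ε < 1) {g B Λ : ℕ} (hk : 1 ≤ k)
    (hB : 2 * (g + 8 : ℕ) * Real.log n / p ≤ B)
    (hpk : p ^ k = (10 / ε * Real.log n)⁻¹) (hΛ : p ^ Λ ≤ ((n : ℝ) ^ 6)⁻¹)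
    (hΛg : Λ ≤ n ^ (g + 1)) {r : (V → Tape) → V → ℕ}
    (hr : ∀ ω v, r ω v = hierarchyLevel (5 * Real.log n / (ε * n)) p k (ω v)) :
    tapeMeasure V {ω | ¬ (G.IsDensityNet ε {v | 0 < r ω v} ∧ (∀ v, r ω v ≤ Λ) ∧
      ∀ t < n, ∀ v w, ∀ i < k, (∃ u ∈ G.hopBall t v w, i + 1 < r ω u) ∨
        {u | u ∈ G.hopBall t v w ∧ i < r ω u}.ncard ≤ B)} ≤ 1 / (n : ENNReal) := by
  classical
  set q := 5 * Real.log n / (ε * n) with hq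
  have hn0 : (0 : ℝ) < n := by exact_mod_cast (by omega : 0 < n)
  have hn2 : (2 : ℝ) ≤ n := by exact_mod_cast hn
  have hlog := one_half_lt_log hn
  have hq0 : 0 ≤ q := by positivity
  let E₁ : Set (V → Tape) := {ω | ¬ G.IsDensityNet ε {v | 0 < hierarchyLevel q p k (ω v)}}
  let E₂ : Set (V → Tape) := {ω | ∃ v, Λ < hierarchyLevel q p k (ω v)}
  let I := Fin n × V × V × {i : Fin Λ // (i : ℕ) < k}
  let E₃ : I → Set (V → Tape) := fun x =>
    {ω | ¬ ((∃ u ∈ G.hopBall x.1 x.2.1 x.2.2.1, x.2.2.2.1 + 1 < hierarchyLevel q p k (ω u)) ∨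
      {u | u ∈ G.hopBall x.1 x.2.1 x.2.2.1 ∧
        (x.2.2.2.1 : ℕ) < hierarchyLevel q p k (ω u)}.ncard ≤ B)}
  have h1 : tapeMeasure V E₁ ≤ ENNReal.ofReal (((n : ℝ) ^ 4)⁻¹ + 5 / 9 * (n : ℝ)⁻¹) :=
    tapeMeasure_not_isDensityNet_le G hV hn hp0 hp1 hε0 hε1 hk
  have h2 : tapeMeasure V E₂ ≤ ENNReal.ofReal (((n : ℝ) ^ 5)⁻¹) :=
    tapeMeasure_high_level_le hV hn hp0 hp1 hΛ q hq0
  have h3 : ∀ x, tapeMeasure V (E₃ x) ≤ ENNReal.ofReal (((n : ℝ) ^ (g + 8))⁻¹) := fun x =>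
    tapeMeasure_crowded_le hV hn hp0 hp1 hε0 (by omega) hB hpk _ x.2.2.2.2
  have hcard : Fintype.card I ≤ n ^ (g + 4) := by
    have h4 : Fintype.card {i : Fin Λ // (i : ℕ) < k} ≤ n ^ (g + 1) :=
      (Fintype.card_subtype_le _).trans ((Fintype.card_fin Λ).le.trans hΛg)
    simp only [I, Fintype.card_prod, Fintype.card_fin, hV]
    calc _ ≤ n * (n * (n * n ^ (g + 1))) := by gcongr
      _ = n ^ (g + 4) := by ring
  have hsub : {ω | ¬ (G.IsDensityNet ε {v | 0 < r ω v} ∧ (∀ v, r ω v ≤ Λ) ∧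
      ∀ t < n, ∀ v w, ∀ i < k, (∃ u ∈ G.hopBall t v w, i + 1 < r ω u) ∨
        {u | u ∈ G.hopBall t v w ∧ i < r ω u}.ncard ≤ B)} ⊆ E₁ ∪ (E₂ ∪ ⋃ x, E₃ x) := by
    intro ω hω
    by_contra hcon
    simp only [Set.mem_union, not_or, Set.mem_iUnion, not_exists] at hcon
    obtain ⟨c1, c2, c3⟩ := hcon
    apply hω
    simp only [hr]
    have c2' : ∀ v, hierarchyLevel q p k (ω v) ≤ Λ := fun v => not_lt.1 fun h => c2 ⟨v, h⟩
    refine ⟨not_not.1 c1, c2', fun t ht v w i hi => ?_⟩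
    by_cases hiΛ : i < Λ
    · exact not_not.1 (c3 ⟨⟨t, ht⟩, v, w, ⟨i, hiΛ⟩, hi⟩)
    · right
      have : {u | u ∈ G.hopBall t v w ∧ i < hierarchyLevel q p k (ω u)} = ∅ := by
        rw [Set.eq_empty_iff_forall_notMem]
        rintro u ⟨-, hu⟩
        have := c2' u
        omega
      rw [this, Set.ncard_empty]
      exact Nat.zero_le _
  have hsum : (n : ℝ) ^ (g + 4) * ((n : ℝ) ^ (g + 8))⁻¹ = ((n : ℝ) ^ 4)⁻¹ := by
    rw [show g + 8 = g + 4 + 4 by omega, pow_add _ (g + 4) 4]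
    field_simp
  calc _ ≤ tapeMeasure V (E₁ ∪ (E₂ ∪ ⋃ x, E₃ x)) := measure_mono hsub
    _ ≤ tapeMeasure V E₁ + tapeMeasure V (E₂ ∪ ⋃ x, E₃ x) := measure_union_le _ _
    _ ≤ tapeMeasure V E₁ + (tapeMeasure V E₂ + ∑ x, tapeMeasure V (E₃ x)) := by
        gcongr
        refine (measure_union_le _ _).trans ?_
        gcongr
        exact measure_iUnion_fintype_le _ _
    _ ≤ tapeMeasure V E₁ + (tapeMeasure V E₂ +
          ∑ _x : I, ENNReal.ofReal (((n : ℝ) ^ (g + 8))⁻¹)) := by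
        gcongr with x
        exact h3 x
    _ ≤ ENNReal.ofReal (((n : ℝ) ^ 4)⁻¹ + 5 / 9 * (n : ℝ)⁻¹) +
          (ENNReal.ofReal (((n : ℝ) ^ 5)⁻¹) + ENNReal.ofReal (((n : ℝ) ^ 4)⁻¹)) := by
        gcongr
        rw [Finset.sum_const, Finset.card_univ, nsmul_eq_mul, ← hsum,
          ENNReal.ofReal_mul (by positivity), ENNReal.ofReal_pow (by positivity),
          ENNReal.ofReal_natCast]
        gcongr
        exact_mod_cast hcard
    _ = ENNReal.ofReal (((n : ℝ) ^ 4)⁻¹ + 5 / 9 * (n : ℝ)⁻¹ +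
          (((n : ℝ) ^ 5)⁻¹ + ((n : ℝ) ^ 4)⁻¹)) := by
        rw [← ENNReal.ofReal_add (by positivity) (by positivity),
          ← ENNReal.ofReal_add (by positivity) (by positivity)]
    _ ≤ ENNReal.ofReal ((n : ℝ)⁻¹) := by
        apply ENNReal.ofReal_le_ofReal
        have hinv : (n : ℝ)⁻¹ ≤ 1 / 2 := by
          rw [inv_le_comm₀ hn0 (by norm_num)]; norm_num; exact hn
        have hinv0 : 0 < (n : ℝ)⁻¹ := by positivity
        rw [← inv_pow, ← inv_pow]
        set z := (n : ℝ)⁻¹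
        have z2 : z ^ 2 ≤ z * (1 / 2) := by nlinarith
        have z3 : z ^ 3 ≤ z * (1 / 4) := by nlinarith
        have z4 : z ^ 4 ≤ z * (1 / 8) := by nlinarith
        have z5 : z ^ 5 ≤ z * (1 / 16) := by nlinarith
        linarith
    _ = 1 / (n : ENNReal) := by
        rw [ENNReal.ofReal_inv_of_pos hn0, ENNReal.ofReal_natCast, one_div]

end

/-! ### Choice of the constants -/

section

variable {n k : ℕ} {ε C : ℝ}

lemma eps_lt_one (hk : 1 ≤ k) (hC : 0 < C) (hkC : (k : ℝ) ≤ C * Real.log (1 / ε)) : ε < 1 := by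
  by_contra h
  have h1 : Real.log (1 / ε) ≤ 0 := by
    rw [one_div, Real.log_inv]
    have := Real.log_nonneg (not_lt.1 h)
    linarith
  have h2 : (1 : ℝ) ≤ k := by exact_mod_cast hk
  nlinarith

/-- The range of `k` keeps the sampling probability away from `1`. -/
lemma sampling_prob_le (hn : 2 ≤ n) (hε : 0 < ε) (hk : 1 ≤ k) (hC : 0 < C)
    (hkC : (k : ℝ) ≤ C * Real.log (1 / ε)) :
    (10 / ε * Real.log n) ^ (-(1 / (k : ℝ))) ≤ Real.exp (-(1 / C)) := by
  have hlog := one_half_lt_log hn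
  have hk0 : (0 : ℝ) < k := by exact_mod_cast hk
  have h1 : Real.log (1 / ε) ≤ Real.log (10 / ε * Real.log n) := by
    apply Real.log_le_log (by positivity)
    rw [div_mul_eq_mul_div]
    gcongr
    linarith
  rw [Real.rpow_def_of_pos (by positivity)]
  apply Real.exp_le_exp.2
  rw [mul_neg, neg_le_neg_iff, mul_one_div, div_le_div_iff₀ hC hk0]
  nlinarith

lemma sampling_prob_pow (hn : 2 ≤ n) (hε : 0 < ε) (hk : 1 ≤ k) :
    ((10 / ε * Real.log n) ^ (-(1 / (k : ℝ)))) ^ k = (10 / ε * Real.log n)⁻¹ := by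
  have hlog := one_half_lt_log hn
  have hk0 : (k : ℝ) ≠ 0 := by exact_mod_cast (by omega : k ≠ 0)
  rw [← Real.rpow_natCast, ← Real.rpow_mul (by positivity), ← Real.rpow_neg_one]
  congr 1
  field_simp

lemma inv_sampling_prob_le (hn : 2 ≤ n) (hε : 0 < ε) (hk : 1 ≤ k) :
    1 / (10 / ε * Real.log n) ^ (-(1 / (k : ℝ))) ≤
      10 * (1 / ε * Real.log n) ^ (1 / (k : ℝ)) := by
  have hlog := one_half_lt_log hn
  have hk1 : (1 : ℝ) ≤ k := by exact_mod_cast hk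
  rw [Real.rpow_neg (by positivity), one_div, inv_inv,
    show 10 / ε * Real.log n = 10 * (1 / ε * Real.log n) by ring,
    Real.mul_rpow (by norm_num) (by positivity)]
  gcongr
  calc (10 : ℝ) ^ (1 / (k : ℝ)) ≤ 10 ^ (1 : ℝ) := by
        apply Real.rpow_le_rpow_of_exponent_le (by norm_num)
        rw [div_le_one (by linarith)]
        exact hk1
    _ = 10 := Real.rpow_one _

end

theorem mainTheorem2 :
    -- `C`: the constant implied in the range `1 ≤ k ≤ O(log (1/ε))`
    -- `K`: the constant implied in all the conclusions
    ∀ C : ℝ, 0 < C → ∃ K : ℝ, 0 < K ∧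
    -- `a`: exponent of the polynomial bound on identities and weights
    -- messages have `b * log₂ n = O(log n)` bits, so there are `n ^ b` different ones
    ∀ a : ℕ, ∃ b : ℕ,
    ∀ n : ℕ, 2 ≤ n → ∀ ε : ℝ, 0 < ε → ∀ k : ℕ, 1 ≤ k → (k : ℝ) ≤ C * Real.log (1 / ε) →
    ∃ alg : DistAlg (n ^ b) (CDGSketch k),
    ∀ (V : Type*) [Fintype V] (G : Network V), Fintype.card V = n → G.PolyBounded a →
      (∀ ω : V → Tape, ∃ R : ℕ, alg.HaltedBy G ω R ∧
        (R : ℝ) ≤ K * (k * G.spDiam * (1 / ε * Real.log n) ^ (1 / (k : ℝ)) * Real.log n) ∧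
        (alg.messageCount G ω R : ℝ) ≤
          K * (k * G.spDiam * G.numEdges * (1 / ε * Real.log n) ^ (1 / (k : ℝ)) * Real.log n)) ∧
      tapeMeasure V {ω | ¬ ∃ sk : V → CDGSketch k,
        (∀ u, alg.Outputs G ω u (sk u)) ∧
        G.IsDensityNet ε (sampledHierarchy ε k ω 0) ∧
        (∀ u, G.IsCDGSketch (sampledHierarchy ε k ω) u (sk u)) ∧
        (∀ u, ((sk u).words : ℝ) ≤
          K * (k * (1 / ε * Real.log n) ^ (1 / (k : ℝ)) * Real.log n)) ∧
        G.HasStretchWithSlack sk (8 * k - 1) ε} ≤ 1 / (n : ENNReal) := by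
  intro C hC
  obtain ⟨g, hg⟩ : ∃ g : ℕ, 6 * C + 1 ≤ 2 ^ g := by
    obtain ⟨g, hg⟩ := pow_unbounded_of_one_lt (6 * C + 1) (one_lt_two)
    exact ⟨g, hg.le⟩
  refine ⟨720 * (g + 10), by positivity, fun a => ⟨(a + g + 3) * 5, ?_⟩⟩
  intro n hn ε hε k hk hkC
  set x := Real.log n with hx
  set X := (1 / ε * x) ^ (1 / (k : ℝ)) with hX
  set p := (10 / ε * x) ^ (-(1 / (k : ℝ))) with hp
  have hlog : 0.69 < x := one_half_lt_log hn
  have hn0 : (0 : ℝ) < n := by exact_mod_cast (by omega : 0 < n)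
  have hn1 : (1 : ℝ) ≤ n := by exact_mod_cast (by omega : 1 ≤ n)
  have hp0 : 0 < p := by positivity
  have hX0 : 0 < X := by positivity
  have hpC : p ≤ Real.exp (-(1 / C)) := sampling_prob_le hn hε hk hC hkC
  have hp1 : p < 1 := hpC.trans_lt (Real.exp_lt_one_iff.2 (by rw [neg_lt_zero]; positivity))
  have hpX : 1 / p ≤ 10 * X := inv_sampling_prob_le hn hε hk
  have hXx : 1 ≤ 20 * (X * x) := by
    have h1 : 1 ≤ 1 / p := by rw [le_div_iff₀ hp0]; linarith
    nlinarith
  -- the bound on the number of entries of one level, and the bound on the levels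
  set B := ⌈2 * (g + 8 : ℕ) * x / p⌉₊ with hB
  set Λ := ⌈6 * C * x⌉₊ with hΛ
  have hBle : (B : ℝ) ≤ 20 * (g + 9) * (X * x) := by
    have h1 : (B : ℝ) ≤ 2 * (g + 8 : ℕ) * x / p + 1 := (Nat.ceil_lt_add_one (by positivity)).le
    have h2 : 2 * (g + 8 : ℕ) * x / p = 2 * (g + 8) * x * (1 / p) := by push_cast; ring
    have h3 : 2 * ((g : ℝ) + 8) * x * (1 / p) ≤ 2 * (g + 8) * x * (10 * X) := by gcongr
    rw [h2] at h1
    linarith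
  have hpΛ : p ^ Λ ≤ ((n : ℝ) ^ 6)⁻¹ := by
    rw [← exp_neg_mul_log hn0 6]
    calc p ^ Λ ≤ Real.exp (-(1 / C)) ^ Λ := by gcongr
      _ = Real.exp (-(1 / C * Λ)) := by rw [← Real.exp_nat_mul]; congr 1; ring
      _ ≤ _ := by
        apply Real.exp_le_exp.2
        rw [neg_le_neg_iff]
        have h1 : 6 * C * x ≤ Λ := Nat.le_ceil _
        calc ((6 : ℕ) : ℝ) * Real.log n = 1 / C * (6 * C * x) := by
              push_cast; field_simp; rw [hx]
          _ ≤ 1 / C * Λ := by gcongr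
  have hΛg : Λ ≤ n ^ (g + 1) := by
    have h1 : (Λ : ℝ) < 6 * C * x + 1 := Nat.ceil_lt_add_one (by positivity)
    have h2 : x ≤ n := (Real.log_le_sub_one_of_pos hn0).trans (by linarith)
    have h3 : (2 : ℝ) ^ g ≤ (n : ℝ) ^ g := by
      gcongr
      exact_mod_cast hn
    have h4 : (Λ : ℝ) ≤ (n : ℝ) ^ (g + 1) := by
      rw [pow_succ]
      calc (Λ : ℝ) ≤ (6 * C + 1) * n := by nlinarith
        _ ≤ (n : ℝ) ^ g * n := by gcongr; exact hg.trans h3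
    exact_mod_cast h4
  have hQ : n ^ (a + 2) ≤ n ^ (a + g + 3) := Nat.pow_le_pow_right (by omega) (by omega)
  have hQ4 : 4 ≤ n ^ (a + g + 3) := by
    calc 4 = 2 ^ 2 := rfl
      _ ≤ n ^ 2 := Nat.pow_le_pow_left hn 2
      _ ≤ _ := Nat.pow_le_pow_right (by omega) (by omega)
  have hΛQ : Λ < n ^ (a + g + 3) :=
    hΛg.trans_lt (Nat.pow_lt_pow_right (by omega) (by omega))
  set q := 5 * Real.log n / (ε * n) with hq
  obtain ⟨alg, halg⟩ := exists_distAlg (W := k * B) k (hierarchyLevel q p k) hQ4 (pow_mul n _ 5)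
  refine ⟨alg, fun V _ G hV hG => ⟨fun ω => ?_, ?_⟩⟩
  · have hS : 1 ≤ G.spDiam := G.one_le_spDiam (by omega)
    have hS' : (1 : ℝ) ≤ G.spDiam := by exact_mod_cast hS
    have hk' : (1 : ℝ) ≤ k := by exact_mod_cast hk
    have hR : (((5 * G.spDiam + 4) * (2 * (k * B) + 2) : ℕ) : ℝ) ≤
        360 * (g + 10) * (k * G.spDiam * X * x) := by
      have h1 : (5 * (G.spDiam : ℝ) + 4) ≤ 9 * G.spDiam := by linarith
      have h2 : 2 * ((k : ℝ) * B) + 2 ≤ 40 * (g + 10) * (k * (X * x)) := by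
        have h3 : (k : ℝ) * B ≤ k * (20 * (g + 9) * (X * x)) := by gcongr
        have h4 : 1 * 1 ≤ (k : ℝ) * (20 * (X * x)) := by gcongr
        nlinarith
      push_cast
      calc (5 * (G.spDiam : ℝ) + 4) * (2 * (k * B) + 2) ≤
            (9 * G.spDiam) * (40 * (g + 10) * (k * (X * x))) := by gcongr
        _ = _ := by ring
    have hpos : 0 ≤ (k : ℝ) * G.spDiam * X * x := by positivity
    refine ⟨_, (halg V G ω).1, hR.trans ?_, ?_⟩
    · nlinarith
    · have h1 := alg.messageCount_le G ω ((5 * G.spDiam + 4) * (2 * (k * B) + 2))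
      calc (alg.messageCount G ω ((5 * G.spDiam + 4) * (2 * (k * B) + 2)) : ℝ) ≤
            (((5 * G.spDiam + 4) * (2 * (k * B) + 2) : ℕ) : ℝ) * (2 * G.numEdges) := by
            exact_mod_cast h1
        _ ≤ 360 * (g + 10) * (k * G.spDiam * X * x) * (2 * G.numEdges) := by gcongr
        _ = _ := by ring
  · refine (measure_mono ?_).trans (tapeMeasure_bad_le G hV hn hp0 hp1 hε (eps_lt_one hk hC hkC) hk
      (Nat.le_ceil _) (sampling_prob_pow hn hε hk) hpΛ hΛg
      (r := fun ω v => hierarchyLevel q p k (ω v)) fun ω v => rfl)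
    intro ω hω hgood
    apply hω
    obtain ⟨hnet, hlev, hball⟩ := hgood
    have hA : ∀ i, sampledHierarchy ε k ω i = {v | i < hierarchyLevel q p k (ω v)} := by
      intro i
      rw [sampledHierarchy_eq, hV]
    have hlevk : ∀ v, hierarchyLevel q p k (ω v) ≤ k := fun v =>
      not_lt.1 fun h => lt_irrefl _ (lt_hierarchyLevel_iff.1 h).1
    have hAk : sampledHierarchy ε k ω k = ∅ := by
      rw [hA, Set.eq_empty_iff_forall_notMem]
      exact fun v hv => absurd hv (not_lt.2 (hlevk v))
    have hnet' : G.IsDensityNet ε (sampledHierarchy ε k ω 0) := by rwa [hA]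
    have hne : (sampledHierarchy ε k ω 0).Nonempty := by
      obtain ⟨v⟩ := G.connected.nonempty
      obtain ⟨w, hw, -⟩ := hnet'.1 v
      exact ⟨w, hw⟩
    have hball' : ∀ t < Fintype.card V, ∀ v w, ∀ i < k,
        (∃ u ∈ G.hopBall t v w, i + 1 < hierarchyLevel q p k (ω u)) ∨
          {u | u ∈ G.hopBall t v w ∧ i < hierarchyLevel q p k (ω u)}.ncard ≤ B :=
      fun t ht => hball t (hV ▸ ht)
    have hsk := G.isCDGSketch_sketchOf (fun v => hierarchyLevel q p k (ω v)) (k := k) hA hne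
    refine ⟨fun v => sketchOf k (G.info (fun v => hierarchyLevel q p k (ω v)) (2 * G.spDiam + 1) v),
      (halg V G ω).2 (G.small_run (by omega) hG (by rwa [hV]) hlevk
        (fun v => (hlev v).trans_lt hΛQ) hball'), hnet', hsk, fun v => ?_,
      Network.hasStretchWithSlack hsk hnet' hAk⟩
    have h1 := G.words_sketchOf_le hball' v
    have hk' : (1 : ℝ) ≤ k := by exact_mod_cast hk
    calc _ ≤ (2 : ℝ) + k * (3 + 2 * B) := by exact_mod_cast h1
      _ ≤ k * (5 + 2 * B) := by nlinarith
      _ ≤ k * (5 * (20 * (X * x)) + 2 * (20 * (g + 9) * (X * x))) := by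
        gcongr
        linarith
      _ ≤ 720 * (g + 10) * (k * X * x) := by
        have h2 : 0 ≤ (k : ℝ) * X * x := by positivity
        have h3 : 0 ≤ (g : ℝ) * (k * X * x) := by positivity
        nlinarith
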